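/- **Setting.** Let $\mathcal X$ (prompts) and $\mathcal A$ (responses) be countable. Let $\rho$ be a probability distribution on $\mathcal X$ and $\pi_{\mathsf{ref}}(\cdot\mid x)$ a reference policy, with $\rho(x)>0$ and $\pi_{\mathsf{ref}}(a\mid x)>0$ for all $x,a$. Let $r^\star:\mathcal X\times\mathcal A\to[0,R_{\max}]$, $R_{\max}>0$, be an unknown reward, and $J(\pi)=\mathbb E_{x\sim\rho,\,a\sim\pi(\cdot\mid x)}[r^\star(x,a)]$. For $i=1,\dots,n$ ($n\ge 1$) independently, $x_i\sim\rho$, $a_i^0,a_i^1\sim\pi_{\mathsf{ref}}(\cdot\mid x_i)$ independently, and the clean label $y_i\in\{0,1\}$ follows the Bradley–Terry law $G_i=\mathrm{Ber}\big(\tfrac{e^{r^\star(x_i,a_i^1)}}{e^{r^\star(x_i,a_i^1)}+e^{r^\star(x_i,a_i^0)}}\big)$. Fix $\varepsilon>0$ and $\alpha\in[0,1/2]$. $\alpha$-Huber corruption replaces the law $G$ of a label by $(1-\alpha)G+\alpha B_i$ with an arbitrary Bernoulli law $B_i$ (which may depend on $i$ and $(x_i,a_i^0,a_i^1)$); $\varepsilon$-randomized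 response keeps a label with probability $e^\varepsilon/(1+e^\varepsilon)$ and flips it otherwise. The observed label $z_i$ is obtained from $y_i$ by corruption followed by randomized response (Corruption-then-LDP, CTL), or by randomized response followed by corruption (LDP-then-Corruption, LTC). **Algorithm (Square $\chi$PO).** Let $\phi(u)=u+\log u$, $\sigma(t)=1/(1+e^{-t})$, $\mathrm{clip}_R(u)=\max\{\min\{u,R\},-R\}$, $c(\varepsilon)=\frac{e^\varepsilon+1}{e^\varepsilon-1}$, $\beta>0$. Given a finite class $\Pi$ of policies, output any $$\hat\pi\in\operatorname*{argmin}_{\pi\in\Pi}\sum_{i=1}^n\Big[2\sigma\Big(\mathrm{clip}_{2R_{\max}}\Big[\beta\phi\Big(\tfrac{\pi(a_i^1\mid x_i)}{\pi_{\mathsf{ref}}(a_i^1\mid x_i)}\Big)-\beta\phi\Big(\tfrac{\pi(a_i^0\mid x_i)}{\pi_{\mathsf{ref}}(a_i^0\mid x_i)}\Big)\Big]\Big)-1-c(\varepsilon)(2z_i-1)\Big]^2 .$$ **Assumptions (for a given $\beta$).** (1) Policy realizability: $\Pi$ contains the policy $\pi^\star_\beta$ that maximizes, over all policies, $J(\pi)-\beta\,[D_{\chi^2}(\pi\|\pi_{\mathsf{ref}})+D_{\mathrm{KL}}(\pi\|\pi_{\mathsf{ref}})]$,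 where the divergences are averaged over $x\sim\rho$ and $D_{\chi^2}(\pi\|\pi_{\mathsf{ref}})=\frac12\mathbb E_{x\sim\rho,\,a\sim\pi_{\mathsf{ref}}(\cdot\mid x)}\big[\big(\tfrac{\pi(a\mid x)}{\pi_{\mathsf{ref}}(a\mid x)}-1\big)^2\big]$. (2) Bounded implicit reward differences: with a parameter $V_{\max}\ge R_{\max}$, every $\pi\in\Pi$ has full support (so that the following is finite) and $\big|\beta\phi\big(\tfrac{\pi(a\mid x)}{\pi_{\mathsf{ref}}(a\mid x)}\big)-\beta\phi\big(\tfrac{\pi(b\mid x)}{\pi_{\mathsf{ref}}(b\mid x)}\big)\big|\le V_{\max}$ for all $x,a,b$. **Theorem.** There is an absolute constant $K>0$ such that, in each of the two settings CTL and LTC, the following holds. Let $\zeta\in(0,1)$, and let $\pi^\star$ be a comparator policy with $\mathcal C^{\pi^\star}:=\mathbb E_{x\sim\rho,\,a\sim\pi^\star(\cdot\mid x)}\big[\tfrac{\pi^\star(a\mid x)}{\pi_{\mathsf{ref}}(a\mid x)}\big]<\infty$. There is a choice of $\beta>0$, depending only on the setting and on $n,|\Pi|,\varepsilon,\alpha,\zeta,R_{\max},V_{\max},\mathcal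 C^{\pi^\star}$, such that, if (1) and (2) hold for this $\beta$, then with probability at least $1-\zeta$ every output $\hat\pi$ of the algorithm satisfies $$J(\pi^\star)-J(\hat\pi)\le K\,\kappa(\pi^\star)\Big(c(\varepsilon)\sqrt{\tfrac{\log(|\Pi|/\zeta)}{n}}+\sqrt{\alpha}\Big)\quad\text{under CTL},$$ $$J(\pi^\star)-J(\hat\pi)\le K\,\kappa(\pi^\star)\Big(c(\varepsilon)\sqrt{\tfrac{\log(|\Pi|/\zeta)}{n}}+\sqrt{\alpha\,c(\varepsilon)}\Big)\quad\text{under LTC},$$ where $\kappa(\pi^\star)=e^{2R_{\max}}\frac{V_{\max}}{R_{\max}}\sqrt{\mathcal C^{\pi^\star}}$. -/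

import Mathlib

open MeasureTheory
open scoped ENNReal NNReal BigOperators

noncomputable section

namespace SquareChiPO

/-! ### Policies, expectations and divergences on countable prompt and response spaces -/

/-- A (stochastic) policy assigns to each prompt a probability mass function on responses. -/
abbrev Policy (X A : Type*) := X → PMF A

section Policies

variable {X A : Type*}

/-- The law of `(x, a)` with `x ∼ ρ` and `a ∼ π(· | x)`. -/
def joint (ρ : PMF X) (π : Policy X A) : PMF (X × A) :=
  ρ.bind fun x => (π x).map fun a => (x, a)

/-- The density ratio `π(a | x) / πref(a | x)`. -/
def ratio (πref π : Policy X A) (x : X) (a : A) : ℝ :=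
  (π x a).toReal / (πref x a).toReal

/-- The value `J(π) = E_{x ∼ ρ, a ∼ π(· | x)} [r(x, a)]`. -/
def value [MeasurableSpace X] [MeasurableSpace A] (ρ : PMF X) (r : X → A → ℝ)
    (π : Policy X A) : ℝ :=
  ∫ p, r p.1 p.2 ∂(joint ρ π).toMeasure

/-- The suboptimality gap `J(πstar) - J(πhat)`. -/
def subGap [MeasurableSpace X] [MeasurableSpace A] (ρ : PMF X) (r : X → A → ℝ)
    (πhat πstar : Policy X A) : ℝ :=
  value ρ r πstar - value ρ r πhat

/-- The single-policy `L₁`-concentrability coefficient `E_π [π(a | x) / πref(a | x)]`,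
which may be infinite. -/
def concentrability [MeasurableSpace X] [MeasurableSpace A] (ρ : PMF X) (πref π : Policy X A) :
    ℝ≥0∞ :=
  ∫⁻ p, π p.1 p.2 / πref p.1 p.2 ∂(joint ρ π).toMeasure

/-- `D_{χ²}(π ‖ πref) = (1/2) E_{x ∼ ρ, a ∼ πref(· | x)} [(π(a | x) / πref(a | x) - 1)²]`. -/
def chiSqDiv [MeasurableSpace X] [MeasurableSpace A] (ρ : PMF X) (π πref : Policy X A) : ℝ≥0∞ :=
  (∫⁻ p, ENNReal.ofReal ((ratio πref π p.1 p.2 - 1) ^ 2) ∂(joint ρ πref).toMeasure) / 2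

/-- `D_{KL}(π ‖ πref) = E_{x ∼ ρ} [KL(π(· | x) ‖ πref(· | x))]`. -/
def klDivPolicy [MeasurableSpace X] [MeasurableSpace A] (ρ : PMF X) (π πref : Policy X A) :
    ℝ≥0∞ :=
  ∫⁻ x, InformationTheory.klDiv (π x).toMeasure (πref x).toMeasure ∂ρ.toMeasure

/-- The mixed `χ²`-regularized objective; it is `-∞` when a divergence is infinite. -/
def mixedObjective [MeasurableSpace X] [MeasurableSpace A] (ρ : PMF X) (πref : Policy X A)
    (r : X → A → ℝ) (β : ℝ) (π : Policy X A) : EReal :=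
  (value ρ r π : EReal) -
    ((ENNReal.ofReal β * (chiSqDiv ρ π πref + klDivPolicy ρ π πref) : ℝ≥0∞) : EReal)

/-- The link function `φ(u) = u + log u` (used for `u > 0` only). -/
def phi (u : ℝ) : ℝ := u + Real.log u

/-- The implicit reward `β φ(π(a | x) / πref(a | x))`. -/
def implicitReward (πref : Policy X A) (β : ℝ) (π : Policy X A) (x : X) (a : A) : ℝ :=
  β * phi (ratio πref π x a)

/-- Policy realizability: the class contains the maximizer, over all policies, of the mixed
`χ²`-regularized objective. -/
def Realizable [MeasurableSpace X] [MeasurableSpace A] (ρ : PMF X) (πref : Policy X A)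
    (r : X → A → ℝ) (β : ℝ) (Pi : Finset (Policy X A)) : Prop :=
  ∃ πβ ∈ Pi, ∀ π : Policy X A, mixedObjective ρ πref r β π ≤ mixedObjective ρ πref r β πβ

/-- Bounded implicit reward differences. Since `φ(0) = -∞`, the implicit rewards are finite only
for policies of full support; this is the first conjunct. -/
def BoundedImplicitReward (πref : Policy X A) (β Vmax : ℝ) (Pi : Finset (Policy X A)) : Prop :=
  ∀ π ∈ Pi, ∀ x : X, (∀ a : A, π x a ≠ 0) ∧
    ∀ a b : A, |implicitReward πref β π x a - implicitReward πref β π x b| ≤ Vmax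

end Policies

/-! ### Labels: Bradley–Terry preferences, Huber corruption and randomized response -/

/-- The Bernoulli law on `Bool` with success probability `p ∈ [0, 1]`
(`p` is projected to `[0, 1]`). -/
def bern (p : ℝ) : PMF Bool :=
  PMF.ofFintype
    (fun b => cond b (ENNReal.ofReal (Set.projIcc (0 : ℝ) 1 zero_le_one p))
      (ENNReal.ofReal (1 - Set.projIcc (0 : ℝ) 1 zero_le_one p))) (by
    have h := (Set.projIcc (0 : ℝ) 1 zero_le_one p).2
    rw [Fintype.sum_bool, cond_true, cond_false, ← ENNReal.ofReal_add h.1 (sub_nonneg.2 h.2)]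
    simp)

/-- The Bradley–Terry probability that the response with reward `r1` is preferred to the response
with reward `r0`. -/
def btProb (r1 r0 : ℝ) : ℝ := Real.exp r1 / (Real.exp r1 + Real.exp r0)

/-- Huber corruption: the mixture `(1 - α) G + α B`. -/
def huber (α : ℝ) (B G : PMF Bool) : PMF Bool :=
  (bern α).bind fun corrupted => if corrupted then B else G

/-- `ε`-randomized response: keep the label with probability `e^ε / (1 + e^ε)`, else flip it. -/
def randResponse (ε : ℝ) (y : Bool) : PMF Bool :=
  (bern (Real.exp ε / (1 + Real.exp ε))).map fun keep => if keep then y else !y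

/-- `c(ε) = (e^ε + 1) / (e^ε - 1)`. -/
def cEps (ε : ℝ) : ℝ := (Real.exp ε + 1) / (Real.exp ε - 1)

/-- The order of corruption and local privatization. -/
inductive Setting
  /-- corruption, then local privacy -/
  | CTL
  /-- local privacy, then corruption -/
  | LTC

/-- The law of the observed label when the clean label has law `G` and the bad law is `B`. -/
def labelLaw (s : Setting) (ε α : ℝ) (B G : PMF Bool) : PMF Bool :=
  match s with
  | .CTL => (huber α B G).bind (randResponse ε)
  | .LTC => huber α B (G.bind (randResponse ε))

/-- The corruption term of the bound in each of the settings. -/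
def corruptionTerm (s : Setting) (ε α : ℝ) : ℝ :=
  match s with
  | .CTL => Real.sqrt α
  | .LTC => Real.sqrt (α * cEps ε)

/-! ### The preference dataset and the algorithm -/

/-- A data point `(x, a⁰, a¹, z)`. -/
abbrev Sample (X A : Type*) := X × A × A × Bool

section Algorithm

variable {X A : Type*}

/-- The law of one data point: `x ∼ ρ`, `a⁰, a¹ ∼ πref(· | x)` independently, and the observed
label `z`, whose clean law is the Bradley–Terry one; the bad label law may depend on the
prompt and the two responses. -/
def sampleLaw (s : Setting) (ρ : PMF X) (πref : Policy X A) (r : X → A → ℝ) (ε α : ℝ)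
    (B : X → A → A → PMF Bool) : PMF (Sample X A) :=
  ρ.bind fun x => (πref x).bind fun a0 => (πref x).bind fun a1 =>
    (labelLaw s ε α (B x a0 a1) (bern (btProb (r x a1) (r x a0)))).map fun z => (x, a0, a1, z)

/-- The law of the dataset: `n` independent data points, the `i`-th with bad label law `B i`. -/
def datasetLaw [MeasurableSpace X] [MeasurableSpace A] (s : Setting) (n : ℕ) (ρ : PMF X)
    (πref : Policy X A) (r : X → A → ℝ) (ε α : ℝ) (B : Fin n → X → A → A → PMF Bool) :
    Measure (Fin n → Sample X A) :=
  Measure.pi fun i => (sampleLaw s ρ πref r ε α (B i)).toMeasure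

/-- `clip_R(u) = max {min {u, R}, -R}`. -/
def clip (R u : ℝ) : ℝ := max (min u R) (-R)

/-- The label in `{-1, 1}`: `2 z - 1`. -/
def signLabel (z : Bool) : ℝ := if z then 1 else -1

/-- The objective of Square `χPO` on a dataset. -/
def squareLoss {n : ℕ} (πref : Policy X A) (Rmax ε β : ℝ) (D : Fin n → Sample X A)
    (π : Policy X A) : ℝ :=
  ∑ i, (2 * Real.sigmoid (clip (2 * Rmax)
      (β * (phi (ratio πref π (D i).1 (D i).2.2.1) - phi (ratio πref π (D i).1 (D i).2.1))))
    - 1 - cEps ε * signLabel (D i).2.2.2) ^ 2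

/-- `πhat` is an output of Square `χPO`: a minimizer over `Pi` of the objective. -/
def IsOutput {n : ℕ} (πref : Policy X A) (Rmax ε β : ℝ) (Pi : Finset (Policy X A))
    (D : Fin n → Sample X A) (πhat : Policy X A) : Prop :=
  πhat ∈ Pi ∧ ∀ π ∈ Pi, squareLoss πref Rmax ε β D πhat ≤ squareLoss πref Rmax ε β D π

end Algorithm

/-- `κ = e^{2 Rmax} (Vmax / Rmax) √C`, where `C` is the concentrability coefficient. -/
def kappa (Rmax Vmax C : ℝ) : ℝ := Real.exp (2 * Rmax) * (Vmax / Rmax) * Real.sqrt C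

end SquareChiPO

end

open SquareChiPO

universe u v

set_option linter.unusedSectionVars false

/-! Write u and v for the density ratios of the output and of the comparator to the reference
policy, h for the implicit reward of the output, R and V for the two bounds.

At the maximizer of the regularized objective, moving a little mass between two responses to one
prompt cannot help. The penalty has derivative φ(u) − 1, so implicit reward differences equal reward
differences (`implicitReward_sub_eq`), and some policy in the class predicts exactly the conditional
mean of the clean label.

The label c(ε)(2z − 1) has conditional mean within 2b of this clean mean, with b = α under CTL and b
= α c(ε) under LTC. The excess square loss of a fixed policy over the clean mean therefore has mean
at least its squared error minus 8b, while its second moment is at most 16 c(ε)² times the squared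
error. This Bernstein-type condition, Chernoff's bound and a union bound give the output a mean
squared error of order b + c(ε)² log(|Π|/ζ)/n (`le_datasetLaw_meanSqError_le`). Undoing sigmoid and
clipping costs a factor of order e^{2R} V/R on its root (`sq_sub_le_sq_sigmoid_clip_sub`).

Since ratios have conditional mean one, the regret is E[(v − u)(d + h)], where d is the error of the
implicit reward differences. The term −βu² contained in −uh pays for the uncontrolled size of u:
`sub_mul_add_le` leaves only βv² and d²/β, so only the comparator's concentrability enters
(`subGap_le`). Balancing these two terms determines β. -/

namespace SquareChiPO

/-! ### Integration against probability mass functions and their densities -/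

section PMFIntegrals

variable {S T : Type*} [Countable S] [Countable T] [MeasurableSpace S]
  [DiscreteMeasurableSpace S] [MeasurableSpace T] [DiscreteMeasurableSpace T]

lemma toMeasure_bind (p : PMF S) (g : S → PMF T) :
    (p.bind g).toMeasure = p.toMeasure.bind fun a => (g a).toMeasure := by
  ext s hs
  rw [PMF.toMeasure_bind_apply _ _ _ hs, Measure.bind_apply hs (Measurable.of_discrete).aemeasurable,
    lintegral_countable']
  refine tsum_congr fun a => ?_
  rw [PMF.toMeasure_apply_singleton _ _ (measurableSet_singleton a), mul_comm]

lemma lintegral_pmf_bind (p : PMF S) (g : S → PMF T) (f : T → ℝ≥0∞) :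
    ∫⁻ y, f y ∂(p.bind g).toMeasure = ∫⁻ x, ∫⁻ y, f y ∂(g x).toMeasure ∂p.toMeasure := by
  rw [toMeasure_bind, Measure.lintegral_bind (Measurable.of_discrete).aemeasurable
    (Measurable.of_discrete).aemeasurable]

lemma integral_pmf_bind (p : PMF S) (g : S → PMF T) {f : T → ℝ}
    (hf : Integrable f (p.bind g).toMeasure) :
    ∫ y, f y ∂(p.bind g).toMeasure = ∫ x, ∫ y, f y ∂(g x).toMeasure ∂p.toMeasure := by
  let κ : ProbabilityTheory.Kernel Unit S := ProbabilityTheory.Kernel.const Unit p.toMeasure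
  let η : ProbabilityTheory.Kernel S T := ⟨fun a => (g a).toMeasure, Measurable.of_discrete⟩
  have h : (η.comp κ) () = (p.bind g).toMeasure := by
    rw [ProbabilityTheory.Kernel.comp_apply, toMeasure_bind]
    rfl
  rw [← h] at hf ⊢
  exact ProbabilityTheory.Kernel.integral_comp hf

lemma toMeasure_pmf_map (p : PMF S) (g : S → T) :
    (p.map g).toMeasure = p.toMeasure.map g := by
  ext s hs
  rw [PMF.toMeasure_map_apply _ _ _ Measurable.of_discrete hs,
    Measure.map_apply Measurable.of_discrete hs]

lemma integral_pmf_map (p : PMF S) (g : S → T) (f : T → ℝ) :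
    ∫ y, f y ∂(p.map g).toMeasure = ∫ x, f (g x) ∂p.toMeasure := by
  rw [toMeasure_pmf_map, integral_map (Measurable.of_discrete).aemeasurable
    (Measurable.of_discrete).aestronglyMeasurable]

lemma lintegral_pmf_map (p : PMF S) (g : S → T) (f : T → ℝ≥0∞) :
    ∫⁻ y, f y ∂(p.map g).toMeasure = ∫⁻ x, f (g x) ∂p.toMeasure := by
  rw [toMeasure_pmf_map, lintegral_map Measurable.of_discrete Measurable.of_discrete]

lemma integrable_pmf_map_iff (p : PMF S) (g : S → T) (f : T → ℝ) :
    Integrable f (p.map g).toMeasure ↔ Integrable (fun x => f (g x)) p.toMeasure := by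
  rw [toMeasure_pmf_map, integrable_map_measure (Measurable.of_discrete).aestronglyMeasurable
    (Measurable.of_discrete).aemeasurable]
  rfl

lemma integrable_of_abs_le {m : Measure S} [IsFiniteMeasure m] {f : S → ℝ} (M : ℝ)
    (h : ∀ x, |f x| ≤ M) : Integrable f m :=
  Integrable.of_bound (Measurable.of_discrete).aestronglyMeasurable M
    (Filter.Eventually.of_forall h)

/-- A probability mass function has a density with respect to one of full support. -/
lemma toMeasure_eq_withDensity (p q : PMF S) (hq : ∀ a, q a ≠ 0) :
    p.toMeasure = q.toMeasure.withDensity fun a => p a / q a := by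
  refine Measure.ext_of_singleton fun a => ?_
  rw [withDensity_apply _ (measurableSet_singleton a), lintegral_singleton,
    PMF.toMeasure_apply_singleton _ _ (measurableSet_singleton a),
    PMF.toMeasure_apply_singleton _ _ (measurableSet_singleton a),
    ENNReal.div_mul_cancel (hq a) (q.apply_ne_top a)]

lemma pmf_div_lt_top (p q : PMF S) (hq : ∀ a, q a ≠ 0) (a : S) : p a / q a < ⊤ :=
  ENNReal.div_lt_top (p.apply_ne_top a) (hq a)

lemma integral_density (p q : PMF S) (hq : ∀ a, q a ≠ 0) (f : S → ℝ) :
    ∫ a, f a ∂p.toMeasure = ∫ a, (p a / q a).toReal * f a ∂q.toMeasure := by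
  rw [toMeasure_eq_withDensity p q hq, integral_withDensity_eq_integral_toReal_smul
    Measurable.of_discrete (Filter.Eventually.of_forall (pmf_div_lt_top p q hq))]
  rfl

lemma lintegral_density (p q : PMF S) (hq : ∀ a, q a ≠ 0) (f : S → ℝ≥0∞) :
    ∫⁻ a, f a ∂p.toMeasure = ∫⁻ a, (p a / q a) * f a ∂q.toMeasure := by
  rw [toMeasure_eq_withDensity p q hq, lintegral_withDensity_eq_lintegral_mul _
    Measurable.of_discrete Measurable.of_discrete]
  rfl

lemma integrable_density (p q : PMF S) (hq : ∀ a, q a ≠ 0) :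
    Integrable (fun a => (p a / q a).toReal) q.toMeasure := by
  refine integrable_toReal_of_lintegral_ne_top (Measurable.of_discrete).aemeasurable ?_
  have := lintegral_density p q hq fun _ => 1
  simp only [lintegral_one, measure_univ, mul_one] at this
  simp [← this]

lemma klDiv_pmf (p q : PMF S) (hq : ∀ a, q a ≠ 0) :
    InformationTheory.klDiv p.toMeasure q.toMeasure =
      ∫⁻ a, ENNReal.ofReal (InformationTheory.klFun (p a / q a).toReal) ∂q.toMeasure := by
  have h := toMeasure_eq_withDensity p q hq
  have hac : p.toMeasure ≪ q.toMeasure := h ▸ withDensity_absolutelyContinuous _ _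
  rw [InformationTheory.klDiv_eq_lintegral_klFun_of_ac hac]
  have h2 : p.toMeasure.rnDeriv q.toMeasure =ᵐ[q.toMeasure] fun a => p a / q a := by
    nth_rewrite 1 [h]
    exact Measure.rnDeriv_withDensity _ Measurable.of_discrete
  refine lintegral_congr_ae ?_
  filter_upwards [h2] with a ha
  rw [ha]

end PMFIntegrals

/-! ### Density ratios and concentrability -/

section Joint

variable {X A : Type*}

lemma joint_apply (ρ : PMF X) (π : Policy X A) (x : X) (a : A) :
    joint ρ π (x, a) = ρ x * π x a := by
  classical
  rw [joint, PMF.bind_apply, tsum_eq_single x]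
  · congr 1
    rw [PMF.map_apply, tsum_eq_single a]
    · simp
    · intro b hb
      simp [hb.symm]
  · intro y hy
    rw [PMF.map_apply]
    simp [hy.symm]

lemma joint_ne_zero {ρ : PMF X} {π : Policy X A} (hρ : ∀ x, ρ x ≠ 0) (hπ : ∀ x a, π x a ≠ 0)
    (p : X × A) : joint ρ π p ≠ 0 := by
  obtain ⟨x, a⟩ := p
  rw [joint_apply]
  exact mul_ne_zero (hρ x) (hπ x a)

lemma joint_div {ρ : PMF X} (hρ : ∀ x, ρ x ≠ 0) (π πref : Policy X A) (p : X × A) :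
    joint ρ π p / joint ρ πref p = π p.1 p.2 / πref p.1 p.2 := by
  obtain ⟨x, a⟩ := p
  rw [joint_apply, joint_apply, ENNReal.mul_div_mul_left _ _ (hρ x) (ρ.apply_ne_top x)]

lemma ratio_eq (πref π : Policy X A) (x : X) (a : A) :
    ratio πref π x a = (π x a / πref x a).toReal := by
  rw [ratio, ENNReal.toReal_div]

lemma ratio_nonneg (πref π : Policy X A) (x : X) (a : A) : 0 ≤ ratio πref π x a := by
  unfold ratio
  positivity

variable [Countable X] [Countable A] [MeasurableSpace X] [DiscreteMeasurableSpace X]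
  [MeasurableSpace A] [DiscreteMeasurableSpace A]

lemma lintegral_joint (ρ : PMF X) (π : Policy X A) (f : X × A → ℝ≥0∞) :
    ∫⁻ p, f p ∂(joint ρ π).toMeasure =
      ∫⁻ x, ∫⁻ a, f (x, a) ∂(π x).toMeasure ∂ρ.toMeasure := by
  rw [joint, lintegral_pmf_bind]
  simp_rw [lintegral_pmf_map]

variable {ρ : PMF X} {πref : Policy X A}

lemma integral_joint_eq (hρ : ∀ x, ρ x ≠ 0) (href : ∀ x a, πref x a ≠ 0) (π : Policy X A)
    (f : X × A → ℝ) :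
    ∫ p, f p ∂(joint ρ π).toMeasure =
      ∫ p, ratio πref π p.1 p.2 * f p ∂(joint ρ πref).toMeasure := by
  rw [integral_density _ _ (joint_ne_zero hρ href)]
  simp_rw [joint_div hρ, ratio_eq]

lemma integrable_ratio (hρ : ∀ x, ρ x ≠ 0) (href : ∀ x a, πref x a ≠ 0) (π : Policy X A) :
    Integrable (fun p : X × A => ratio πref π p.1 p.2) (joint ρ πref).toMeasure := by
  have := integrable_density (joint ρ π) _ (joint_ne_zero hρ href)
  simpa only [joint_div hρ, ← ratio_eq] using this

lemma integral_ratio (hρ : ∀ x, ρ x ≠ 0) (href : ∀ x a, πref x a ≠ 0) (π : Policy X A) :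
    ∫ p, ratio πref π p.1 p.2 ∂(joint ρ πref).toMeasure = 1 := by
  have := integral_joint_eq hρ href π fun _ => 1
  simpa using this.symm

lemma integral_ratio_fiber (href : ∀ x a, πref x a ≠ 0) (π : Policy X A) (x : X) :
    ∫ a, ratio πref π x a ∂(πref x).toMeasure = 1 := by
  have := integral_density (π x) (πref x) (href x) fun _ => 1
  simp_rw [ratio_eq]
  simpa using this.symm

lemma integrable_ratio_fiber (href : ∀ x a, πref x a ≠ 0) (π : Policy X A) (x : X) :
    Integrable (fun a => ratio πref π x a) (πref x).toMeasure := by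
  simpa only [← ratio_eq] using integrable_density (π x) (πref x) (href x)

lemma concentrability_eq_lintegral (hρ : ∀ x, ρ x ≠ 0) (href : ∀ x a, πref x a ≠ 0)
    (π : Policy X A) :
    concentrability ρ πref π =
      ∫⁻ p, ENNReal.ofReal (ratio πref π p.1 p.2 ^ 2) ∂(joint ρ πref).toMeasure := by
  rw [concentrability, lintegral_density _ _ (joint_ne_zero hρ href)]
  refine lintegral_congr fun p => ?_
  rw [joint_div hρ, ratio_eq, sq, ENNReal.ofReal_mul ENNReal.toReal_nonneg, ENNReal.ofReal_toReal]
  exact (pmf_div_lt_top _ _ (href p.1) p.2).ne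

lemma integrable_ratio_sq (hρ : ∀ x, ρ x ≠ 0) (href : ∀ x a, πref x a ≠ 0) {π : Policy X A}
    {C : ℝ≥0} (hC : concentrability ρ πref π = C) :
    Integrable (fun p : X × A => ratio πref π p.1 p.2 ^ 2) (joint ρ πref).toMeasure := by
  rw [concentrability_eq_lintegral hρ href] at hC
  refine (lintegral_ofReal_ne_top_iff_integrable
    (Measurable.of_discrete).aestronglyMeasurable
    (Filter.Eventually.of_forall fun _ => sq_nonneg _)).1 ?_
  simp [hC]

lemma integral_ratio_sq (hρ : ∀ x, ρ x ≠ 0) (href : ∀ x a, πref x a ≠ 0) {π : Policy X A}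
    {C : ℝ≥0} (hC : concentrability ρ πref π = C) :
    ∫ p, ratio πref π p.1 p.2 ^ 2 ∂(joint ρ πref).toMeasure = C := by
  rw [concentrability_eq_lintegral hρ href] at hC
  rw [integral_eq_lintegral_of_nonneg_ae (Filter.Eventually.of_forall fun _ => sq_nonneg _)
    (Measurable.of_discrete).aestronglyMeasurable, hC]
  simp

/-- Integrate u ≤ (u² + 1)/2, the ratio having mean one. This rules out C = 0 when β is divided by
√C. -/
lemma one_le_concentrability (hρ : ∀ x, ρ x ≠ 0) (href : ∀ x a, πref x a ≠ 0) {π : Policy X A}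
    {C : ℝ≥0} (hC : concentrability ρ πref π = C) : (1 : ℝ) ≤ C := by
  have h : ∫ p, ratio πref π p.1 p.2 ∂(joint ρ πref).toMeasure ≤
      ∫ p, (ratio πref π p.1 p.2 ^ 2 + 1) / 2 ∂(joint ρ πref).toMeasure := by
    refine integral_mono (integrable_ratio hρ href π)
      (((integrable_ratio_sq hρ href hC).add (integrable_const 1)).div_const 2) fun p => ?_
    dsimp only
    nlinarith [sq_nonneg (ratio πref π p.1 p.2 - 1)]
  rw [integral_ratio hρ href, integral_div, integral_add (integrable_ratio_sq hρ href hC)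
    (integrable_const 1), integral_ratio_sq hρ href hC] at h
  simp at h
  linarith

end Joint


/-! ### The regularized objective as a real integral -/

open InformationTheory (klFun)

/-- The integrand of the mixed regularized objective as a function of the density ratio. -/
noncomputable def objIntegrand (β c u : ℝ) : ℝ := u * c - β * ((u - 1) ^ 2 / 2 + klFun u)

lemma hasDerivAt_objIntegrand (β c : ℝ) {u : ℝ} (hu : u ≠ 0) :
    HasDerivAt (objIntegrand β c) (c - β * (phi u - 1)) u := by
  have h1 : HasDerivAt (fun u : ℝ => u * c) (1 * c) u := (hasDerivAt_id u).mul_const c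
  have h2 : HasDerivAt (fun u : ℝ => (u - 1) ^ 2 / 2) (u - 1) u := by
    have := (((hasDerivAt_id u).sub_const 1).pow 2).div_const 2
    simpa using this
  have h3 := h1.sub ((h2.add (InformationTheory.hasDerivAt_klFun hu)).const_mul β)
  refine h3.congr_deriv ?_
  unfold phi
  ring

lemma exists_abs_objIntegrand_le (β M R : ℝ) :
    ∃ B : ℝ, ∀ u c, 0 ≤ u → u ≤ M → |c| ≤ R → |objIntegrand β c u| ≤ B := by
  obtain ⟨B, hB⟩ := (isCompact_Icc (a := (0 : ℝ)) (b := M)).exists_bound_of_continuousOn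
    (f := fun u => β * ((u - 1) ^ 2 / 2 + klFun u))
    (by have := InformationTheory.continuous_klFun; fun_prop)
  refine ⟨M * R + B, fun u c h0 hM hc => ?_⟩
  have h1 := hB u ⟨h0, hM⟩
  rw [Real.norm_eq_abs] at h1
  calc |objIntegrand β c u| ≤ |u * c| + |β * ((u - 1) ^ 2 / 2 + klFun u)| := abs_sub _ _
    _ ≤ M * R + B := by
      rw [abs_mul, abs_of_nonneg h0]
      gcongr
      linarith

section Objective

variable {X A : Type*} [Countable X] [Countable A] [MeasurableSpace X] [DiscreteMeasurableSpace X]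
  [MeasurableSpace A] [DiscreteMeasurableSpace A] {ρ : PMF X} {πref : Policy X A}

lemma klDivPolicy_eq (href : ∀ x a, πref x a ≠ 0) (π : Policy X A) :
    klDivPolicy ρ π πref =
      ∫⁻ p, ENNReal.ofReal (klFun (ratio πref π p.1 p.2)) ∂(joint ρ πref).toMeasure := by
  rw [klDivPolicy, lintegral_joint]
  simp_rw [klDiv_pmf _ _ (href _), ratio_eq]

lemma chiSqDiv_add_klDivPolicy (href : ∀ x a, πref x a ≠ 0) (π : Policy X A) :
    chiSqDiv ρ π πref + klDivPolicy ρ π πref =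
      ∫⁻ p, ENNReal.ofReal ((ratio πref π p.1 p.2 - 1) ^ 2 / 2 + klFun (ratio πref π p.1 p.2))
        ∂(joint ρ πref).toMeasure := by
  rw [klDivPolicy_eq href, chiSqDiv, div_eq_mul_inv, ← lintegral_mul_const _ Measurable.of_discrete,
    ← lintegral_add_left Measurable.of_discrete]
  refine lintegral_congr fun p => ?_
  rw [ENNReal.ofReal_add (by positivity) (InformationTheory.klFun_nonneg (ratio_nonneg _ _ _ _)),
    ENNReal.ofReal_div_of_pos two_pos, div_eq_mul_inv]
  simp

lemma integrable_objIntegrand {β M R : ℝ} {r : X → A → ℝ} {π : Policy X A}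
    (hM : ∀ x a, ratio πref π x a ≤ M) (hr : ∀ x a, |r x a| ≤ R) :
    Integrable (fun p : X × A => objIntegrand β (r p.1 p.2) (ratio πref π p.1 p.2))
      (joint ρ πref).toMeasure := by
  obtain ⟨B, hB⟩ := exists_abs_objIntegrand_le β M R
  exact integrable_of_abs_le B fun p => hB _ _ (ratio_nonneg _ _ _ _) (hM _ _) (hr _ _)

/-- Bounded ratios make both divergences finite, so the extended-real objective becomes one real
integral over the reference law, whose integrand can be differentiated in the ratio. -/
lemma mixedObjective_eq (hρ : ∀ x, ρ x ≠ 0) (href : ∀ x a, πref x a ≠ 0) {β M R : ℝ} (hβ : 0 ≤ β)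
    {r : X → A → ℝ} {π : Policy X A}
    (hM : ∀ x a, ratio πref π x a ≤ M) (hr : ∀ x a, |r x a| ≤ R) :
    mixedObjective ρ πref r β π =
      ((∫ p, objIntegrand β (r p.1 p.2) (ratio πref π p.1 p.2) ∂(joint ρ πref).toMeasure : ℝ) :
        EReal) := by
  have hI1 : Integrable (fun p : X × A => ratio πref π p.1 p.2 * r p.1 p.2)
      (joint ρ πref).toMeasure := by
    simpa [objIntegrand] using integrable_objIntegrand (ρ := ρ) (β := 0) hM hr
  have hI2 : Integrable (fun p : X × A => (ratio πref π p.1 p.2 - 1) ^ 2 / 2 +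
      klFun (ratio πref π p.1 p.2)) (joint ρ πref).toMeasure := by
    have := (integrable_objIntegrand (ρ := ρ) (β := 1) (r := fun _ _ => 0) (R := 0) hM
      (by simp)).neg
    refine this.congr (Filter.Eventually.of_forall fun p => ?_)
    simp [objIntegrand]
  have hnn : ∀ p : X × A, 0 ≤ (ratio πref π p.1 p.2 - 1) ^ 2 / 2 +
      klFun (ratio πref π p.1 p.2) := fun p =>
    add_nonneg (by positivity) (InformationTheory.klFun_nonneg (ratio_nonneg _ _ _ _))
  rw [mixedObjective, chiSqDiv_add_klDivPolicy href, value, integral_joint_eq hρ href,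
    ← ofReal_integral_eq_lintegral_ofReal hI2 (Filter.Eventually.of_forall hnn),
    ← ENNReal.ofReal_mul hβ, EReal.coe_ennreal_ofReal,
    max_eq_left (mul_nonneg hβ (integral_nonneg hnn)), ← EReal.coe_sub, ← integral_const_mul,
    ← integral_sub hI1 (hI2.const_mul β)]
  rfl

end Objective

/-! ### First-order optimality by moving mass between two responses -/

section Transport

variable {A : Type*}

open Classical in
/-- Move mass `s` from the atom `a` to the atom `b`. -/
noncomputable def transport (p : PMF A) (a b : A) (s : ℝ≥0∞) (hab : a ≠ b) (hs : s ≤ p a) :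
    PMF A :=
  ⟨fun c => if c = a then p a - s else if c = b then p b + s else p c, by
    refine (ENNReal.summable.hasSum_iff).2 ?_
    have hs' : s ≠ ⊤ := (hs.trans_lt (p.apply_lt_top a)).ne
    -- Adding s at a to the new weights gives the same function as adding s at b to the old ones;
    -- the finite s then cancels from the sums.
    have h : ∀ c, (if c = a then p a - s else if c = b then p b + s else p c) +
        (if c = a then s else 0) = p c + (if c = b then s else 0) := by
      intro c
      by_cases hca : c = a
      · subst hca
        simp [hab, tsub_add_cancel_of_le hs]
      · by_cases hcb : c = b
        · subst hcb
          simp [hca]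
        · simp [hca, hcb]
    have h2 := tsum_congr (L := .unconditional _) h
    rw [ENNReal.tsum_add, ENNReal.tsum_add, tsum_ite_eq, tsum_ite_eq, p.tsum_coe] at h2
    exact (ENNReal.add_left_inj hs').1 h2⟩

variable (p : PMF A) {a b : A} {s : ℝ≥0∞} (hab : a ≠ b) (hs : s ≤ p a)

lemma transport_source : transport p a b s hab hs a = p a - s := by
  simp [transport, DFunLike.coe]

lemma transport_target : transport p a b s hab hs b = p b + s := by
  simp [transport, DFunLike.coe, hab.symm]

lemma transport_of_ne {c : A} (hca : c ≠ a) (hcb : c ≠ b) :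
    transport p a b s hab hs c = p c := by
  simp [transport, DFunLike.coe, hca, hcb]

end Transport

lemma deriv_nonpos_of_right_max {f : ℝ → ℝ} {f' δ : ℝ} (hδ : 0 < δ) (hf : HasDerivAt f f' 0)
    (hmax : ∀ t, 0 < t → t < δ → f t ≤ f 0) : f' ≤ 0 := by
  have h := hf.hasDerivWithinAt (s := Set.Ioi 0)
  rw [hasDerivWithinAt_iff_tendsto_slope' (by simp)] at h
  refine le_of_tendsto h ?_
  filter_upwards [Ioo_mem_nhdsGT hδ] with t ht
  rw [slope_def_field]
  exact div_nonpos_of_nonpos_of_nonneg (sub_nonpos.2 (hmax t ht.1 ht.2)) (by linarith [ht.1])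

section FirstOrder

variable {X A : Type*} [Countable X] [Countable A] [MeasurableSpace X] [DiscreteMeasurableSpace X]
  [MeasurableSpace A] [DiscreteMeasurableSpace A] {ρ : PMF X} {πref : Policy X A}

lemma integral_sub_of_eqOn_compl {S : Type*} [Countable S] [MeasurableSpace S]
    [DiscreteMeasurableSpace S] (p : PMF S) {f g : S → ℝ} (hf : Integrable f p.toMeasure)
    (hg : Integrable g p.toMeasure) {a b : S} (hab : a ≠ b)
    (h : ∀ c, c ≠ a → c ≠ b → f c = g c) :
    ∫ c, f c ∂p.toMeasure - ∫ c, g c ∂p.toMeasure =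
      (p a).toReal * (f a - g a) + (p b).toReal * (f b - g b) := by
  classical
  rw [← integral_sub hf hg, PMF.integral_eq_tsum p (fun c => f c - g c) (hf.sub hg),
    tsum_eq_sum (s := {a, b}), Finset.sum_pair hab]
  · rfl
  · intro c hc
    simp only [Finset.mem_insert, Finset.mem_singleton, not_or] at hc
    simp [h c hc.1 hc.2]

/-- Moving mass t from a to b changes only two atoms, so the objective changes by ρ(x)(f t − f 0)
for an explicit f. Optimality forces the right derivative at 0 to be nonpositive. Exchanging a and b
gives the reverse inequality. -/
lemma reward_sub_implicitReward_le (hρ : ∀ x, ρ x ≠ 0) (href : ∀ x a, πref x a ≠ 0)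
    {β M R : ℝ} (hβ : 0 < β) {r : X → A → ℝ} {π : Policy X A} (hfull : ∀ x a, π x a ≠ 0)
    (hM : ∀ x a, ratio πref π x a ≤ M) (hr : ∀ x a, |r x a| ≤ R)
    (hmax : ∀ π', mixedObjective ρ πref r β π' ≤ mixedObjective ρ πref r β π)
    (x : X) {a b : A} (hab : a ≠ b) :
    r x b - implicitReward πref β π x b ≤ r x a - implicitReward πref β π x a := by
  classical
  have pos : ∀ (p : PMF A) c, p c ≠ 0 → 0 < (p c).toReal := fun p c h =>
    ENNReal.toReal_pos h (p.apply_ne_top c)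
  have ha := pos _ _ (hfull x a)
  have hra := pos _ _ (href x a)
  have hrb := pos _ _ (href x b)
  have hx : 0 < (ρ x).toReal := ENNReal.toReal_pos (hρ x) (ρ.apply_ne_top x)
  have hua : ratio πref π x a ≠ 0 := (div_pos ha hra).ne'
  have hub : ratio πref π x b ≠ 0 := (div_pos (pos _ _ (hfull x b)) hrb).ne'
  let ga := fun t : ℝ => objIntegrand β (r x a) (ratio πref π x a - t / (πref x a).toReal)
  let gb := fun t : ℝ => objIntegrand β (r x b) (ratio πref π x b + t / (πref x b).toReal)
  let f := fun t : ℝ => (πref x a).toReal * ga t + (πref x b).toReal * gb t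
  have hga : HasDerivAt ga (-(r x a - β * (phi (ratio πref π x a) - 1)) / (πref x a).toReal) 0 := by
    have h0 : ratio πref π x a - 0 / (πref x a).toReal = ratio πref π x a := by simp
    have h1 : HasDerivAt (fun t : ℝ => ratio πref π x a - t / (πref x a).toReal)
        (-(1 / (πref x a).toReal)) 0 := ((hasDerivAt_id (0 : ℝ)).div_const _).const_sub _
    have h2 := HasDerivAt.comp (0 : ℝ) (h₂ := objIntegrand β (r x a))
      (by rw [h0]; exact hasDerivAt_objIntegrand β (r x a) hua) h1
    refine h2.congr_deriv ?_
    ring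
  have hgb : HasDerivAt gb ((r x b - β * (phi (ratio πref π x b) - 1)) / (πref x b).toReal) 0 := by
    have h0 : ratio πref π x b + 0 / (πref x b).toReal = ratio πref π x b := by simp
    have h1 : HasDerivAt (fun t : ℝ => ratio πref π x b + t / (πref x b).toReal)
        (1 / (πref x b).toReal) 0 := ((hasDerivAt_id (0 : ℝ)).div_const _).const_add _
    have h2 := HasDerivAt.comp (0 : ℝ) (h₂ := objIntegrand β (r x b))
      (by rw [h0]; exact hasDerivAt_objIntegrand β (r x b) hub) h1
    refine h2.congr_deriv ?_
    ring
  have hf : HasDerivAt f (-(r x a - β * (phi (ratio πref π x a) - 1)) +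
      (r x b - β * (phi (ratio πref π x b) - 1))) 0 := by
    refine ((hga.const_mul _).add (hgb.const_mul _)).congr_deriv ?_
    rw [mul_div_cancel₀ _ hra.ne', mul_div_cancel₀ _ hrb.ne']
  have key : ∀ t, 0 < t → t < (π x a).toReal → f t ≤ f 0 := by
    intro t ht hta
    have hs : ENNReal.ofReal t ≤ π x a :=
      (ENNReal.ofReal_le_iff_le_toReal ((π x).apply_ne_top a)).2 hta.le
    let π' : Policy X A := Function.update π x (transport (π x) a b (ENNReal.ofReal t) hab hs)
    have hπ'a : ratio πref π' x a = ratio πref π x a - t / (πref x a).toReal := by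
      simp only [ratio, π', Function.update_self, transport_source]
      rw [ENNReal.toReal_sub_of_le hs ((π x).apply_ne_top a), ENNReal.toReal_ofReal ht.le, sub_div]
    have hπ'b : ratio πref π' x b = ratio πref π x b + t / (πref x b).toReal := by
      simp only [ratio, π', Function.update_self, transport_target]
      rw [ENNReal.toReal_add ((π x).apply_ne_top b) ENNReal.ofReal_ne_top,
        ENNReal.toReal_ofReal ht.le, add_div]
    have hπ' : ∀ p : X × A, p ≠ (x, a) → p ≠ (x, b) →
        ratio πref π' p.1 p.2 = ratio πref π p.1 p.2 := by
      rintro ⟨y, c⟩ h1 h2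
      by_cases hy : y = x
      · subst hy
        simp only [ne_eq, Prod.mk.injEq, true_and] at h1 h2
        simp only [ratio, π', Function.update_self, transport_of_ne _ hab hs h1 h2]
      · simp [ratio, π', Function.update_of_ne hy]
    have hM' : ∀ y c, ratio πref π' y c ≤ M + t / (πref x b).toReal := by
      intro y c
      have hd : 0 < t / (πref x b).toReal := by positivity
      have hd' : 0 < t / (πref x a).toReal := by positivity
      by_cases h1 : (y, c) = (x, a)
      · cases h1
        linarith [hM x a]
      by_cases h2 : (y, c) = (x, b)
      · cases h2
        linarith [hM x b]
      linarith [hπ' (y, c) h1 h2, hM y c]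
    have h := hmax π'
    rw [mixedObjective_eq hρ href hβ.le hM hr, mixedObjective_eq hρ href hβ.le hM' hr,
      EReal.coe_le_coe_iff] at h
    have h3 := integral_sub_of_eqOn_compl (joint ρ πref)
      (integrable_objIntegrand (β := β) hM' hr) (integrable_objIntegrand (β := β) hM hr)
      (a := (x, a)) (b := (x, b)) (by simpa using hab) (fun p h1 h2 => by rw [hπ' p h1 h2])
    rw [joint_apply, joint_apply, ENNReal.toReal_mul, ENNReal.toReal_mul] at h3
    simp only [hπ'a, hπ'b] at h3
    have h4 : (ρ x).toReal * (f t - f 0) ≤ 0 := by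
      simp only [f, ga, gb, zero_div, sub_zero, add_zero]
      linarith
    exact sub_nonpos.1 (nonpos_of_mul_nonpos_right h4 hx)
  have := deriv_nonpos_of_right_max ha hf key
  unfold implicitReward
  linarith

/-- The maximizer of the regularized objective has implicit reward equal to the reward up to a
function of the prompt. -/
lemma implicitReward_sub_eq (hρ : ∀ x, ρ x ≠ 0) (href : ∀ x a, πref x a ≠ 0)
    {β M R : ℝ} (hβ : 0 < β) {r : X → A → ℝ} {π : Policy X A} (hfull : ∀ x a, π x a ≠ 0)
    (hM : ∀ x a, ratio πref π x a ≤ M) (hr : ∀ x a, |r x a| ≤ R)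
    (hmax : ∀ π', mixedObjective ρ πref r β π' ≤ mixedObjective ρ πref r β π) (x : X) (a b : A) :
    implicitReward πref β π x a - implicitReward πref β π x b = r x a - r x b := by
  by_cases hab : a = b
  · simp [hab]
  have h1 := reward_sub_implicitReward_le hρ href hβ hfull hM hr hmax x hab
  have h2 := reward_sub_implicitReward_le hρ href hβ hfull hM hr hmax x (Ne.symm hab)
  linarith

/-- A ratio of two probability mass functions is at most one somewhere and at least one
somewhere. -/
lemma exists_ratio_le_one (href : ∀ x a, πref x a ≠ 0) (π : Policy X A) (x : X) :
    ∃ a, ratio πref π x a ≤ 1 := by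
  by_contra! h
  have h1 := integral_ratio_fiber href π x
  have h2 : 0 < ∫ a, (ratio πref π x a - 1) ∂(πref x).toMeasure := by
    rw [integral_pos_iff_support_of_nonneg (fun a => (sub_pos.2 (h a)).le)
      ((integrable_ratio_fiber href π x).sub (integrable_const 1))]
    have : Function.support (fun a => ratio πref π x a - 1) = Set.univ := by
      ext a
      simpa using (sub_pos.2 (h a)).ne'
    simp [this]
  rw [integral_sub (integrable_ratio_fiber href π x) (integrable_const 1), h1] at h2
  simp at h2

lemma exists_one_le_ratio (href : ∀ x a, πref x a ≠ 0) (π : Policy X A) (x : X) :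
    ∃ a, 1 ≤ ratio πref π x a := by
  by_contra! h
  have h1 := integral_ratio_fiber href π x
  have h2 : 0 < ∫ a, (1 - ratio πref π x a) ∂(πref x).toMeasure := by
    rw [integral_pos_iff_support_of_nonneg (fun a => (sub_pos.2 (h a)).le)
      ((integrable_const 1).sub (integrable_ratio_fiber href π x))]
    have : Function.support (fun a => 1 - ratio πref π x a) = Set.univ := by
      ext a
      simpa using (sub_pos.2 (h a)).ne'
    simp [this]
  rw [integral_sub (integrable_const 1) (integrable_ratio_fiber href π x), h1] at h2
  simp at h2

/-! ### Pointwise bounds from bounded implicit reward differences -/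

variable {β V : ℝ} {Pi : Finset (Policy X A)} {π : Policy X A}

lemma ratio_pos_of_bounded (href : ∀ x a, πref x a ≠ 0)
    (hB : BoundedImplicitReward πref β V Pi) (hπ : π ∈ Pi) (x : X) (a : A) :
    0 < ratio πref π x a :=
  div_pos (ENNReal.toReal_pos ((hB π hπ x).1 a) ((π x).apply_ne_top a))
    (ENNReal.toReal_pos (href x a) ((πref x).apply_ne_top a))

/-- The ratio is at most 1 at some response and at least 1 at another, and φ(1) = 1. The implicit
reward is thus at most β somewhere and at least β somewhere, and its oscillation is at most V. -/
lemma abs_implicitReward_le (href : ∀ x a, πref x a ≠ 0) (hβ : 0 < β)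
    (hB : BoundedImplicitReward πref β V Pi) (hπ : π ∈ Pi) (x : X) (a : A) :
    |implicitReward πref β π x a| ≤ β + V := by
  obtain ⟨b, hb⟩ := exists_ratio_le_one href π x
  obtain ⟨c, hc⟩ := exists_one_le_ratio href π x
  have h1 := abs_le.1 ((hB π hπ x).2 a b)
  have h2 := abs_le.1 ((hB π hπ x).2 a c)
  have hb' : implicitReward πref β π x b ≤ β := by
    have := Real.log_nonpos (ratio_nonneg πref π x b) hb
    unfold implicitReward phi
    nlinarith
  have hc' : β ≤ implicitReward πref β π x c := by
    have := Real.log_nonneg hc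
    unfold implicitReward phi
    nlinarith
  rw [abs_le]
  constructor <;> linarith

lemma ratio_le_of_bounded (href : ∀ x a, πref x a ≠ 0) (hβ : 0 < β)
    (hB : BoundedImplicitReward πref β V Pi) (hπ : π ∈ Pi) (x : X) (a : A) :
    ratio πref π x a ≤ 1 + V / β := by
  have h := (abs_le.1 (abs_implicitReward_le href hβ hB hπ x a)).2
  have hV : 0 ≤ V := (abs_nonneg _).trans ((hB π hπ x).2 a a)
  have hVβ : 0 ≤ V / β := by positivity
  by_cases h1 : ratio πref π x a ≤ 1
  · linarith
  have hl := Real.log_nonneg (not_le.1 h1).le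
  have h2 : phi (ratio πref π x a) ≤ (β + V) / β := by
    rw [le_div_iff₀ hβ, mul_comm]
    exact h
  rw [add_div, div_self hβ.ne'] at h2
  unfold phi at h2
  linarith

end FirstOrder


/-! ### Means of corrupted and privatized labels -/

section Labels

/-- The mean of a label in `{-1, 1}`. -/
noncomputable def signMean (G : PMF Bool) : ℝ := (G true).toReal - (G false).toReal

lemma toReal_add_toReal (G : PMF Bool) : (G true).toReal + (G false).toReal = 1 := by
  have h := G.tsum_coe
  rw [tsum_fintype, Fintype.sum_bool] at h
  rw [← ENNReal.toReal_add (G.apply_ne_top _) (G.apply_ne_top _), h, ENNReal.toReal_one]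

lemma abs_signMean_le (G : PMF Bool) : |signMean G| ≤ 1 := by
  have h := toReal_add_toReal G
  have h1 : 0 ≤ (G true).toReal := ENNReal.toReal_nonneg
  have h2 : 0 ≤ (G false).toReal := ENNReal.toReal_nonneg
  rw [signMean, abs_le]
  constructor <;> linarith

lemma bern_true {p : ℝ} (h0 : 0 ≤ p) (h1 : p ≤ 1) : (bern p true).toReal = p := by
  simp [bern, Set.projIcc_of_mem zero_le_one ⟨h0, h1⟩, ENNReal.toReal_ofReal h0]

lemma bern_false {p : ℝ} (h0 : 0 ≤ p) (h1 : p ≤ 1) : (bern p false).toReal = 1 - p := by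
  have := toReal_add_toReal (bern p)
  rw [bern_true h0 h1] at this
  linarith

lemma toReal_bind_bool (G : PMF Bool) (k : Bool → PMF Bool) (z : Bool) :
    ((G.bind k) z).toReal =
      (G true).toReal * (k true z).toReal + (G false).toReal * (k false z).toReal := by
  rw [PMF.bind_apply, tsum_fintype, Fintype.sum_bool, ENNReal.toReal_add, ENNReal.toReal_mul,
    ENNReal.toReal_mul] <;>
  exact ENNReal.mul_ne_top (PMF.apply_ne_top _ _) (PMF.apply_ne_top _ _)

lemma signMean_bind (G : PMF Bool) (k : Bool → PMF Bool) :
    signMean (G.bind k) =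
      (G true).toReal * signMean (k true) + (G false).toReal * signMean (k false) := by
  simp only [signMean, toReal_bind_bool]
  ring

lemma signMean_huber {α : ℝ} (h0 : 0 ≤ α) (h1 : α ≤ 1) (B G : PMF Bool) :
    signMean (huber α B G) = α * signMean B + (1 - α) * signMean G := by
  rw [huber, signMean_bind, bern_true h0 h1, bern_false h0 h1]
  simp

lemma cEps_one_le {ε : ℝ} (hε : 0 < ε) : 1 ≤ cEps ε := by
  have h : 1 < Real.exp ε := Real.one_lt_exp_iff.2 hε
  rw [cEps, le_div_iff₀ (by linarith)]
  linarith

/-- The keep probability minus the flip probability is (e^ε − 1)/(e^ε + 1), which is why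
multiplication by c(ε) debiases. -/
lemma signMean_randResponse {ε : ℝ} (hε : 0 < ε) (y : Bool) :
    signMean (randResponse ε y) = signLabel y / cEps ε := by
  have hp := Real.exp_pos ε
  have h : 1 < Real.exp ε := Real.one_lt_exp_iff.2 hε
  have h0 : 0 ≤ Real.exp ε / (1 + Real.exp ε) := by positivity
  have h1 : Real.exp ε / (1 + Real.exp ε) ≤ 1 := by
    rw [div_le_one (by positivity)]
    linarith
  rw [randResponse, ← PMF.bind_pure_comp, signMean_bind, bern_true h0 h1, bern_false h0 h1, cEps]
  have h2 : Real.exp ε - 1 ≠ 0 := by linarith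
  cases y <;> simp [signMean, PMF.pure_apply, signLabel] <;> field_simp <;> ring

lemma signMean_bind_randResponse {ε : ℝ} (hε : 0 < ε) (G : PMF Bool) :
    signMean (G.bind (randResponse ε)) = signMean G / cEps ε := by
  rw [signMean_bind, signMean_randResponse hε, signMean_randResponse hε, signMean]
  simp only [signLabel]
  simp
  ring

/-- The square of the corruption term. -/
noncomputable def corruptionLevel (s : Setting) (ε α : ℝ) : ℝ :=
  match s with
  | .CTL => α
  | .LTC => α * cEps ε

lemma corruptionTerm_eq (s : Setting) (ε α : ℝ) :
    corruptionTerm s ε α = Real.sqrt (corruptionLevel s ε α) := by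
  cases s <;> rfl

lemma corruptionLevel_nonneg (s : Setting) {ε α : ℝ} (hε : 0 < ε) (hα : 0 ≤ α) :
    0 ≤ corruptionLevel s ε α := by
  have := cEps_one_le hε
  cases s
  · exact hα
  · exact mul_nonneg hα (by linarith)

/-- The debiased observed label has almost the same conditional mean as the clean one. -/
lemma abs_cEps_mul_signMean_sub_le (s : Setting) {ε α : ℝ} (hε : 0 < ε) (h0 : 0 ≤ α)
    (h1 : α ≤ 1) (B G : PMF Bool) :
    |cEps ε * signMean (labelLaw s ε α B G) - signMean G| ≤ 2 * corruptionLevel s ε α := by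
  have hc := cEps_one_le hε
  have hc0 : cEps ε ≠ 0 := by linarith
  have hB := abs_le.1 (abs_signMean_le B)
  have hG := abs_le.1 (abs_signMean_le G)
  cases s
  · simp only [labelLaw, corruptionLevel]
    rw [signMean_bind_randResponse hε, mul_div_cancel₀ _ hc0, signMean_huber h0 h1, abs_le]
    constructor <;> nlinarith
  · simp only [labelLaw, corruptionLevel]
    rw [signMean_huber h0 h1, signMean_bind_randResponse hε]
    -- Under LTC the bad label is not shrunk by randomized response, so debiasing inflates it by
    -- c(ε); under CTL the two factors cancel.
    have : cEps ε * (α * signMean B + (1 - α) * (signMean G / cEps ε)) - signMean G =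
        α * cEps ε * signMean B - α * signMean G := by
      field_simp
      ring
    rw [this, abs_le]
    have hac : 0 ≤ α * cEps ε := by positivity
    have hac' : α ≤ α * cEps ε := by nlinarith
    constructor <;> nlinarith

lemma btProb_eq_sigmoid (r1 r0 : ℝ) : btProb r1 r0 = Real.sigmoid (r1 - r0) := by
  rw [btProb, Real.sigmoid_def, neg_sub, Real.exp_sub]
  have h1 := Real.exp_pos r1
  have h2 := Real.exp_pos r0
  field_simp

lemma signMean_bern_btProb (r1 r0 : ℝ) :
    signMean (bern (btProb r1 r0)) = 2 * Real.sigmoid (r1 - r0) - 1 := by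
  rw [btProb_eq_sigmoid, signMean, bern_true (Real.sigmoid_nonneg _) (Real.sigmoid_le_one _),
    bern_false (Real.sigmoid_nonneg _) (Real.sigmoid_le_one _)]
  ring

end Labels

/-! ### Exponential moments of the excess loss -/

/-- The excess squared loss of the prediction `f` over `g` for the label `y`. -/
def excessLoss (f g y : ℝ) : ℝ := (f - y) ^ 2 - (g - y) ^ 2

lemma abs_excessLoss_le {c f g : ℝ} (hc : 1 ≤ c) (hf : |f| ≤ 1) (hg : |g| ≤ 1) (z : Bool) :
    |excessLoss f g (c * signLabel z)| ≤ 4 * c * |f - g| := by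
  have h : excessLoss f g (c * signLabel z) = (f + g - 2 * (c * signLabel z)) * (f - g) := by
    unfold excessLoss
    ring
  rw [h, abs_mul]
  refine mul_le_mul_of_nonneg_right ?_ (abs_nonneg _)
  rw [abs_le] at *
  cases z <;> simp [signLabel] <;> constructor <;> linarith

/-- With l = 1/(32c²) the exponent lies in [−1, 1], so e^x ≤ 1 + x + x² applies, and x² ≤ l(f −
g)²/2 uses up only half of the quadratic gain in the mean. The label bias costs at most 8b, because
|f − g| ≤ 2. -/
lemma sum_exp_excessLoss_le (G : PMF Bool) {c f g b : ℝ} (hc : 1 ≤ c) (hf : |f| ≤ 1)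
    (hg : |g| ≤ 1) (hb : |c * signMean G - g| ≤ 2 * b) :
    (G true).toReal * Real.exp (-(1 / (32 * c ^ 2)) * excessLoss f g (c * signLabel true)) +
      (G false).toReal * Real.exp (-(1 / (32 * c ^ 2)) * excessLoss f g (c * signLabel false)) ≤
    1 + (1 / (32 * c ^ 2)) * (8 * b - (f - g) ^ 2 / 2) := by
  set l : ℝ := 1 / (32 * c ^ 2) with hl
  have hl0 : 0 < l := by positivity
  have hlc : l * (32 * c ^ 2) = 1 := by
    rw [hl]
    field_simp
  have hd : |f - g| ≤ 2 := by
    rw [abs_le] at *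
    constructor <;> linarith
  have key : ∀ z, Real.exp (-l * excessLoss f g (c * signLabel z)) ≤
      1 - l * excessLoss f g (c * signLabel z) + l * ((f - g) ^ 2 / 2) := by
    intro z
    have h1 := abs_excessLoss_le hc hf hg z
    set L := excessLoss f g (c * signLabel z)
    have h2 : |-l * L| ≤ 1 := by
      rw [abs_mul, abs_neg, abs_of_pos hl0]
      calc l * |L| ≤ l * (4 * c * 2) := by gcongr; exact h1.trans (by gcongr)
        _ ≤ l * (32 * c ^ 2) := mul_le_mul_of_nonneg_left (by nlinarith) hl0.le
        _ = 1 := hlc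
    have h3 := (abs_le.1 (Real.abs_exp_sub_one_sub_id_le h2)).2
    have h4 : L ^ 2 ≤ 16 * c ^ 2 * (f - g) ^ 2 := by
      rw [← sq_abs L, ← sq_abs (f - g)]
      calc |L| ^ 2 ≤ (4 * c * |f - g|) ^ 2 := by gcongr
        _ = _ := by ring
    have h5 : (-l * L) ^ 2 ≤ l * ((f - g) ^ 2 / 2) := by
      calc (-l * L) ^ 2 = l * (l * L ^ 2) := by ring
        _ ≤ l * (l * (16 * c ^ 2 * (f - g) ^ 2)) := by gcongr
        _ = l * ((l * (32 * c ^ 2)) * ((f - g) ^ 2 / 2)) := by ring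
        _ = _ := by rw [hlc, one_mul]
    linarith
  have hG := toReal_add_toReal G
  have h1 := mul_le_mul_of_nonneg_left (key true) (ENNReal.toReal_nonneg (a := G true))
  have h2 := mul_le_mul_of_nonneg_left (key false) (ENNReal.toReal_nonneg (a := G false))
  have hmean : (G true).toReal * excessLoss f g (c * signLabel true) +
      (G false).toReal * excessLoss f g (c * signLabel false) =
      (f - g) ^ 2 - 2 * ((f - g) * (c * signMean G - g)) := by
    have : (G false).toReal = 1 - (G true).toReal := by linarith
    simp only [excessLoss, signMean, signLabel, this]
    simp
    ring
  have h3 : (f - g) * (c * signMean G - g) ≤ 4 * b := by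
    calc (f - g) * (c * signMean G - g) ≤ |f - g| * |c * signMean G - g| := by
          rw [← abs_mul]; exact le_abs_self _
      _ ≤ 2 * (2 * b) := mul_le_mul hd hb (abs_nonneg _) zero_le_two
      _ = 4 * b := by ring
  have h4 : l * ((f - g) ^ 2 - 8 * b) ≤ l * ((G true).toReal * excessLoss f g (c * signLabel true) +
      (G false).toReal * excessLoss f g (c * signLabel false)) := by
    rw [hmean]
    exact mul_le_mul_of_nonneg_left (by linarith) hl0.le
  have h5 : ((G true).toReal + (G false).toReal) * (1 + l * ((f - g) ^ 2 / 2)) =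
      1 + l * ((f - g) ^ 2 / 2) := by rw [hG, one_mul]
  linarith

/-! ### Uniform control of the mean squared error -/

section Concentration

variable {X A : Type*}

/-- The law of `(x, a⁰, a¹)`. -/
noncomputable def tripleLaw (ρ : PMF X) (πref : Policy X A) : PMF (X × A × A) :=
  ρ.bind fun x => (πref x).bind fun a0 => (πref x).map fun a1 => (x, a0, a1)

/-- The conditional mean of the clean label in `{-1, 1}`. -/
noncomputable def cleanMean (r : X → A → ℝ) (t : X × A × A) : ℝ :=
  2 * Real.sigmoid (r t.1 t.2.2 - r t.1 t.2.1) - 1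

/-- The prompt and the two responses of a data point. -/
def Sample.triple (D : Sample X A) : X × A × A := (D.1, D.2.1, D.2.2.1)

/-- The mean squared error of the prediction `F` of the clean label. -/
noncomputable def meanSqError [MeasurableSpace X] [MeasurableSpace A] (ρ : PMF X)
    (πref : Policy X A) (r : X → A → ℝ) (F : X × A × A → ℝ) : ℝ :=
  ∫ t, (F t - cleanMean r t) ^ 2 ∂(tripleLaw ρ πref).toMeasure

lemma abs_two_mul_sigmoid_sub_one_le (x : ℝ) : |2 * Real.sigmoid x - 1| ≤ 1 := by
  have h0 := Real.sigmoid_nonneg x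
  have h1 := Real.sigmoid_le_one x
  rw [abs_le]
  constructor <;> linarith

lemma sampleLaw_eq (s : Setting) (ρ : PMF X) (πref : Policy X A) (r : X → A → ℝ) (ε α : ℝ)
    (B : X → A → A → PMF Bool) :
    sampleLaw s ρ πref r ε α B = (tripleLaw ρ πref).bind fun t =>
      (labelLaw s ε α (B t.1 t.2.1 t.2.2) (bern (btProb (r t.1 t.2.2) (r t.1 t.2.1)))).map
        fun z => (t.1, t.2.1, t.2.2, z) := by
  simp only [sampleLaw, tripleLaw, PMF.bind_bind, PMF.bind_map]
  rfl

variable [Countable X] [Countable A] [MeasurableSpace X] [DiscreteMeasurableSpace X]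
  [MeasurableSpace A] [DiscreteMeasurableSpace A] {ρ : PMF X} {πref : Policy X A}

lemma integrable_exp_excessLoss {c l : ℝ} (hc : 1 ≤ c) (r : X → A → ℝ) {F : X × A × A → ℝ}
    (hF : ∀ t, |F t| ≤ 1) (m : Measure (Sample X A)) [IsFiniteMeasure m] :
    Integrable (fun D : Sample X A => Real.exp
      (l * excessLoss (F D.triple) (cleanMean r D.triple) (c * signLabel D.2.2.2))) m := by
  refine integrable_of_abs_le (Real.exp (|l| * (4 * c * 2))) fun D => ?_
  have hg : |cleanMean r D.triple| ≤ 1 := abs_two_mul_sigmoid_sub_one_le _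
  have h := abs_excessLoss_le hc (hF D.triple) hg D.2.2.2
  have hd : |F D.triple - cleanMean r D.triple| ≤ 2 :=
    (abs_sub _ _).trans (by linarith [hF D.triple])
  rw [Real.abs_exp, Real.exp_le_exp]
  refine (le_abs_self _).trans ?_
  rw [abs_mul]
  gcongr
  exact h.trans (by gcongr)

lemma integral_exp_excessLoss_le (s : Setting) {ε α : ℝ} (hε : 0 < ε) (h0 : 0 ≤ α)
    (h1 : α ≤ 1) (r : X → A → ℝ) (B : X → A → A → PMF Bool) {F : X × A × A → ℝ}
    (hF : ∀ t, |F t| ≤ 1) :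
    ∫ D, Real.exp (-(1 / (32 * cEps ε ^ 2)) *
        excessLoss (F D.triple) (cleanMean r D.triple) (cEps ε * signLabel D.2.2.2))
      ∂(sampleLaw s ρ πref r ε α B).toMeasure ≤
    Real.exp ((1 / (32 * cEps ε ^ 2)) *
      (8 * corruptionLevel s ε α - meanSqError ρ πref r F / 2)) := by
  have hc := cEps_one_le hε
  have hint := integrable_exp_excessLoss (l := -(1 / (32 * cEps ε ^ 2))) hc r hF
    (sampleLaw s ρ πref r ε α B).toMeasure
  have hg : ∀ t, |cleanMean r t| ≤ 1 := fun t => abs_two_mul_sigmoid_sub_one_le _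
  have hsq : Integrable (fun t => (F t - cleanMean r t) ^ 2) (tripleLaw ρ πref).toMeasure := by
    refine integrable_of_abs_le 4 fun t => ?_
    rw [abs_of_nonneg (sq_nonneg _), ← sq_abs]
    have : |F t - cleanMean r t| ≤ 2 := (abs_sub _ _).trans (by linarith [hF t, hg t])
    nlinarith [abs_nonneg (F t - cleanMean r t)]
  -- Before exponentiation the conditional bound is affine in the squared error, so averaging over
  -- prompts and responses produces the mean squared error.
  refine le_trans ?_ (Real.add_one_le_exp _)
  rw [sampleLaw_eq] at hint ⊢
  rw [integral_pmf_bind _ _ hint]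
  have hpt : ∀ t : X × A × A, ∫ D, Real.exp (-(1 / (32 * cEps ε ^ 2)) *
        excessLoss (F (Sample.triple D)) (cleanMean r (Sample.triple D))
          (cEps ε * signLabel D.2.2.2))
      ∂((labelLaw s ε α (B t.1 t.2.1 t.2.2) (bern (btProb (r t.1 t.2.2) (r t.1 t.2.1)))).map
        fun z => (t.1, t.2.1, t.2.2, z)).toMeasure ≤
      1 + (1 / (32 * cEps ε ^ 2)) *
        (8 * corruptionLevel s ε α - (F t - cleanMean r t) ^ 2 / 2) := by
    intro t
    rw [integral_pmf_map, PMF.integral_eq_sum, Fintype.sum_bool]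
    refine sum_exp_excessLoss_le _ hc (hF t) (hg t) ?_
    have := abs_cEps_mul_signMean_sub_le s hε h0 h1 (B t.1 t.2.1 t.2.2)
      (bern (btProb (r t.1 t.2.2) (r t.1 t.2.1)))
    rwa [signMean_bern_btProb] at this
  have hI1 : Integrable (fun t => 8 * corruptionLevel s ε α - (F t - cleanMean r t) ^ 2 / 2)
      (tripleLaw ρ πref).toMeasure := (integrable_const _).sub (hsq.div_const 2)
  have hI2 : Integrable (fun t => (1 / (32 * cEps ε ^ 2)) *
      (8 * corruptionLevel s ε α - (F t - cleanMean r t) ^ 2 / 2))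
      (tripleLaw ρ πref).toMeasure := hI1.const_mul _
  have hI : Integrable (fun t => 1 + (1 / (32 * cEps ε ^ 2)) *
        (8 * corruptionLevel s ε α - (F t - cleanMean r t) ^ 2 / 2))
        (tripleLaw ρ πref).toMeasure :=
    (integrable_const _).add hI2
  refine (integral_mono_of_nonneg (Filter.Eventually.of_forall fun t =>
    integral_nonneg fun _ => (Real.exp_pos _).le) hI (Filter.Eventually.of_forall hpt)).trans ?_
  rw [integral_add (integrable_const _) hI2,
    integral_const_mul, integral_sub (integrable_const _) (hsq.div_const 2), integral_div]
  simp [meanSqError]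
  linarith

/-- Chernoff's bound at level zero. The factors need not be identically distributed, which
accommodates bad laws depending on i. -/
lemma pi_sum_nonpos_le {S : Type*} [MeasurableSpace S] {n : ℕ} (m : Fin n → Measure S)
    [∀ i, IsProbabilityMeasure (m i)] {L : S → ℝ} {l b : ℝ} (hl : 0 ≤ l)
    (hint : ∀ i, Integrable (fun x => Real.exp (-l * L x)) (m i))
    (hb : ∀ i, ∫ x, Real.exp (-l * L x) ∂m i ≤ b) :
    Measure.pi m {D | ∑ i, L (D i) ≤ 0} ≤ ENNReal.ofReal (b ^ n) := by
  have hexp : ∀ D : Fin n → S, Real.exp (l * -∑ i, L (D i)) = ∏ i, Real.exp (-l * L (D i)) := by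
    intro D
    rw [← Real.exp_sum, ← Finset.mul_sum, mul_neg, neg_mul]
  have hI : Integrable (fun D : Fin n → S => Real.exp (l * -∑ i, L (D i))) (Measure.pi m) := by
    simp_rw [hexp]
    exact Integrable.fintype_prod_dep hint
  have hmk := ProbabilityTheory.measure_ge_le_exp_mul_mgf (X := fun D : Fin n → S =>
    -∑ i, L (D i)) 0 hl hI
  have hset : {D : Fin n → S | ∑ i, L (D i) ≤ 0} = {D | 0 ≤ -∑ i, L (D i)} := by
    ext D
    simp
  rw [hset, ← ENNReal.ofReal_toReal (measure_ne_top (Measure.pi m) _)]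
  refine ENNReal.ofReal_le_ofReal (hmk.trans ?_)
  rw [mul_zero, Real.exp_zero, one_mul, ProbabilityTheory.mgf]
  simp_rw [hexp]
  rw [integral_fintype_prod_eq_prod (f := fun _ x => Real.exp (-l * L x))]
  refine (Finset.prod_le_prod (fun i _ => integral_nonneg fun _ => (Real.exp_pos _).le)
    fun i _ => hb i).trans ?_
  simp

lemma datasetLaw_sum_excessLoss_nonpos_le (s : Setting) (n : ℕ) {ε α : ℝ} (hε : 0 < ε)
    (h0 : 0 ≤ α) (h1 : α ≤ 1) (r : X → A → ℝ) (B : Fin n → X → A → A → PMF Bool)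
    {F : X × A × A → ℝ} (hF : ∀ t, |F t| ≤ 1) :
    datasetLaw s n ρ πref r ε α B {D | ∑ i, excessLoss (F (D i).triple)
      (cleanMean r (D i).triple) (cEps ε * signLabel (D i).2.2.2) ≤ 0} ≤
    ENNReal.ofReal (Real.exp (n * ((1 / (32 * cEps ε ^ 2)) *
      (8 * corruptionLevel s ε α - meanSqError ρ πref r F / 2)))) := by
  have hc := cEps_one_le hε
  rw [Real.exp_nat_mul]
  exact pi_sum_nonpos_le _ (by positivity)
    (fun i => integrable_exp_excessLoss hc r hF (sampleLaw s ρ πref r ε α (B i)).toMeasure)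
    fun i => integral_exp_excessLoss_le s hε h0 h1 r (B i) hF

/-- With probability at least `1 - ζ`, every prediction of a finite family that fits the labels at
least as well as the clean mean has small mean squared error. -/
lemma le_datasetLaw_meanSqError_le {ι : Type*} (s : Setting) {n : ℕ} (hn : 0 < n) {ε α ζ : ℝ}
    (hε : 0 < ε) (h0 : 0 ≤ α) (h1 : α ≤ 1) (hζ : 0 < ζ) (r : X → A → ℝ)
    (B : Fin n → X → A → A → PMF Bool) (I : Finset ι) {F : ι → X × A × A → ℝ}
    (hF : ∀ i t, |F i t| ≤ 1) :
    ENNReal.ofReal (1 - ζ) ≤ datasetLaw s n ρ πref r ε α B {D | ∀ j ∈ I,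
      ∑ i, excessLoss (F j (D i).triple) (cleanMean r (D i).triple)
        (cEps ε * signLabel (D i).2.2.2) ≤ 0 →
      meanSqError ρ πref r (F j) ≤
        16 * corruptionLevel s ε α + 64 * cEps ε ^ 2 * (Real.log (I.card / ζ) / n)} := by
  classical
  set thr := 16 * corruptionLevel s ε α + 64 * cEps ε ^ 2 * (Real.log (I.card / ζ) / n) with hthr
  set m := datasetLaw s n ρ πref r ε α B with hm
  have : IsProbabilityMeasure m := by
    rw [hm, datasetLaw]
    infer_instance
  have hc := cEps_one_le hε
  let bad : ι → Set (Fin n → Sample X A) := fun j =>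
    {D | ∑ i, excessLoss (F j (D i).triple) (cleanMean r (D i).triple)
        (cEps ε * signLabel (D i).2.2.2) ≤ 0}
  -- The union bound runs over the indices of large error only; the threshold makes the Chernoff
  -- bound of each at most ζ/|I|.
  let J := I.filter fun j => thr < meanSqError ρ πref r (F j)
  have hbad : m (⋃ j ∈ J, bad j) ≤ ENNReal.ofReal ζ := by
    rcases I.eq_empty_or_nonempty with hI | hI
    · simp [J, hI]
    have hN : (0 : ℝ) < I.card := by exact_mod_cast hI.card_pos
    have hn' : (0 : ℝ) < n := by exact_mod_cast hn
    have hj : ∀ j ∈ J, m (bad j) ≤ ENNReal.ofReal (ζ / I.card) := by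
      intro j hj
      refine (datasetLaw_sum_excessLoss_nonpos_le s n hε h0 h1 r B (hF j)).trans
        (ENNReal.ofReal_le_ofReal ?_)
      have h2 : thr < meanSqError ρ πref r (F j) := (Finset.mem_filter.1 hj).2
      have hlog : Real.log (ζ / I.card) = -Real.log (I.card / ζ) := by
        rw [← Real.log_inv, inv_div]
      rw [← Real.le_log_iff_exp_le (by positivity), hlog]
      calc (n : ℝ) * ((1 / (32 * cEps ε ^ 2)) *
            (8 * corruptionLevel s ε α - meanSqError ρ πref r (F j) / 2))
          ≤ n * ((1 / (32 * cEps ε ^ 2)) * (8 * corruptionLevel s ε α - thr / 2)) := by gcongr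
        _ = -Real.log (I.card / ζ) := by
          rw [hthr]
          field_simp
          ring
    calc m (⋃ j ∈ J, bad j) ≤ ∑ j ∈ J, m (bad j) := measure_biUnion_finset_le _ _
      _ ≤ ∑ _j ∈ J, ENNReal.ofReal (ζ / I.card) := Finset.sum_le_sum hj
      _ ≤ ∑ _j ∈ I, ENNReal.ofReal (ζ / I.card) :=
        Finset.sum_le_sum_of_subset (Finset.filter_subset _ _)
      _ = ENNReal.ofReal ζ := by
        rw [Finset.sum_const, nsmul_eq_mul, ← ENNReal.ofReal_natCast,
          ← ENNReal.ofReal_mul (by positivity)]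
        congr 1
        field_simp
  have hsub : (⋃ j ∈ J, bad j)ᶜ ⊆ {D | ∀ j ∈ I,
      ∑ i, excessLoss (F j (D i).triple) (cleanMean r (D i).triple)
        (cEps ε * signLabel (D i).2.2.2) ≤ 0 → meanSqError ρ πref r (F j) ≤ thr} := by
    intro D hD j hjI hj
    by_contra hlt
    exact hD (Set.mem_biUnion (Finset.mem_coe.2 (Finset.mem_filter.2 ⟨hjI, not_le.1 hlt⟩)) hj)
  refine le_trans ?_ (measure_mono hsub)
  rw [prob_compl_eq_one_sub (MeasurableSet.of_discrete), ENNReal.ofReal_sub _ hζ.le,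
    ENNReal.ofReal_one]
  exact tsub_le_tsub_left hbad 1

end Concentration


/-! ### Inverting the sigmoid and the clipping -/

lemma exp_mul_sub_le_sigmoid_sub {R s t : ℝ} (hs : |s| ≤ R) (ht : |t| ≤ R) (hst : s ≤ t) :
    1 / (4 * Real.exp R) * (t - s) ≤ Real.sigmoid t - Real.sigmoid s := by
  refine Convex.mul_sub_le_image_sub_of_le_deriv (convex_Icc (-R) R)
    continuous_sigmoid.continuousOn differentiable_sigmoid.differentiableOn
    (fun x hx => ?_) s (abs_le.1 hs) t (abs_le.1 ht) hst
  rw [interior_Icc] at hx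
  rw [Real.deriv_sigmoid]
  dsimp only
  rw [← Real.sigmoid_neg, Real.sigmoid_def, Real.sigmoid_def, neg_neg, ← mul_inv, one_div]
  -- The derivative is 1/((1 + e^{−x})(1 + e^x)) = 1/(2 + e^x + e^{−x}), at least 1/(4e^R) on [−R,
  -- R].
  have h1 : Real.exp x ≤ Real.exp R := Real.exp_le_exp.2 hx.2.le
  have h2 : Real.exp (-x) ≤ Real.exp R := Real.exp_le_exp.2 (by linarith [hx.1])
  have h3 : 1 ≤ Real.exp R := Real.one_le_exp ((abs_nonneg s).trans hs)
  have h4 : Real.exp (-x) * Real.exp x = 1 := by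
    rw [← Real.exp_add]
    simp
  have h5 := Real.exp_pos x
  have h6 := Real.exp_pos (-x)
  apply inv_anti₀ (by positivity)
  nlinarith

lemma abs_sub_le_exp_mul_abs_sigmoid_sub {R s t : ℝ} (hs : |s| ≤ R) (ht : |t| ≤ R) :
    |s - t| ≤ 4 * Real.exp R * |Real.sigmoid s - Real.sigmoid t| := by
  have hpos : (0 : ℝ) < 4 * Real.exp R := by positivity
  rcases le_total s t with h | h
  · have h1 := exp_mul_sub_le_sigmoid_sub hs ht h
    rw [one_div, inv_mul_le_iff₀ hpos] at h1
    rw [abs_sub_comm, abs_of_nonneg (sub_nonneg.2 h), abs_sub_comm,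
      abs_of_nonneg (sub_nonneg.2 (Real.sigmoid_le h))]
    exact h1
  · have h1 := exp_mul_sub_le_sigmoid_sub ht hs h
    rw [one_div, inv_mul_le_iff₀ hpos] at h1
    rw [abs_of_nonneg (sub_nonneg.2 h), abs_of_nonneg (sub_nonneg.2 (Real.sigmoid_le h))]
    exact h1

lemma abs_clip_le {R : ℝ} (hR : 0 ≤ R) (w : ℝ) : |clip R w| ≤ R := by
  rw [clip, abs_le]
  exact ⟨le_max_right _ _, max_le (min_le_right _ _) (by linarith)⟩

lemma clip_of_abs_le {R w : ℝ} (h : |w| ≤ R) : clip R w = w := by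
  rw [abs_le] at h
  rw [clip, min_eq_left h.2, max_eq_left h.1]

/-- If clipping is active, the clipped value ±2R is at distance at least R from s, whereas |s − w| ≤
2V. Clipping at 2R instead of R creates this gap. -/
lemma abs_sub_le_abs_sub_clip {R V s w : ℝ} (hR : 0 < R) (hRV : R ≤ V) (hs : |s| ≤ R)
    (hw : |w| ≤ V) : |s - w| ≤ 2 * (V / R) * |s - clip (2 * R) w| := by
  have hVR : 1 ≤ V / R := (one_le_div hR).2 hRV
  by_cases h : |w| ≤ 2 * R
  · rw [clip_of_abs_le h]
    nlinarith [abs_nonneg (s - w)]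
  · have h1 : R ≤ |s - clip (2 * R) w| := by
      have h2 : |clip (2 * R) w| = 2 * R := by
        rcases lt_abs.1 (not_le.1 h) with h | h
        · rw [clip, min_eq_right h.le, max_eq_left (by linarith), abs_of_pos (by linarith)]
        · rw [clip, min_eq_left (by linarith), max_eq_right (by linarith), abs_neg,
            abs_of_pos (by linarith)]
      have h3 := abs_sub_abs_le_abs_sub (clip (2 * R) w) s
      rw [h2, abs_sub_comm] at h3
      linarith
    calc |s - w| ≤ |s| + |w| := abs_sub _ _
      _ ≤ 2 * V := by linarith
      _ = 2 * (V / R) * R := by field_simp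
      _ ≤ _ := by gcongr

/-- Squared errors of clipped predictions control those of the unclipped differences. -/
lemma sq_sub_le_sq_sigmoid_clip_sub {R V s w : ℝ} (hR : 0 < R) (hRV : R ≤ V) (hs : |s| ≤ R)
    (hw : |w| ≤ V) :
    (s - w) ^ 2 ≤ (4 * (Real.exp (2 * R) * (V / R))) ^ 2 *
      ((2 * Real.sigmoid (clip (2 * R) w) - 1) - (2 * Real.sigmoid s - 1)) ^ 2 := by
  have hV : 0 < V := hR.trans_le hRV
  have h1 := abs_sub_le_abs_sub_clip hR hRV hs hw
  have h2 := abs_sub_le_exp_mul_abs_sigmoid_sub (hs.trans (by linarith : R ≤ 2 * R))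
    (abs_clip_le (by linarith : 0 ≤ 2 * R) w)
  rw [← mul_pow, sq_le_sq, abs_mul, abs_of_pos (by positivity : 0 < 4 * (Real.exp (2 * R) *
    (V / R)))]
  have h3 : (2 * Real.sigmoid (clip (2 * R) w) - 1) - (2 * Real.sigmoid s - 1) =
      -(2 * (Real.sigmoid s - Real.sigmoid (clip (2 * R) w))) := by ring
  rw [h3, abs_neg, abs_mul, abs_two]
  calc |s - w| ≤ 2 * (V / R) * |s - clip (2 * R) w| := h1
    _ ≤ 2 * (V / R) * (4 * Real.exp (2 * R) *
        |Real.sigmoid s - Real.sigmoid (clip (2 * R) w)|) := by gcongr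
    _ = _ := by ring

/-! ### From squared error to regret -/

/-- Use log u ≤ u − 1, u log u ≥ u − 1 and 2uv ≤ 2v² + u²/2. The linear part of φ leaves −u²/2 to
spare. -/
lemma sub_mul_phi_le {u v : ℝ} (hu : 0 < u) (hv : 0 ≤ v) :
    (v - u) * phi u ≤ 2 * v ^ 2 - u ^ 2 / 2 + (1 - u - v) := by
  have h1 := Real.log_le_sub_one_of_pos hu
  have h2 : u - 1 ≤ u * Real.log u := by
    have := mul_le_mul_of_nonneg_left (Real.one_sub_inv_le_log_of_pos hu) hu.le
    rwa [mul_sub, mul_inv_cancel₀ hu.ne', mul_one] at this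
  have h3 := mul_le_mul_of_nonneg_left h1 hv
  unfold phi
  nlinarith [sq_nonneg (u - 2 * v)]

/-- AM–GM on vd and −ud; the resulting βu²/2 is cancelled exactly by the spare −βu²/2, so no second
moment of u survives. -/
lemma sub_mul_add_le {u v β d : ℝ} (hβ : 0 < β) (hu : 0 < u) (hv : 0 ≤ v) :
    (v - u) * (d + β * phi u) ≤ 5 / 2 * β * v ^ 2 + d ^ 2 / β + β * (1 - u - v) := by
  have h1 := mul_le_mul_of_nonneg_left (sub_mul_phi_le hu hv) hβ.le
  have h2 : v * d ≤ β * v ^ 2 / 2 + d ^ 2 / β / 2 := by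
    have : d ^ 2 / β = β * (d / β) ^ 2 := by field_simp
    have h' : v * d = β * (v * (d / β)) := by field_simp
    rw [this, h']
    nlinarith [sq_nonneg (v - d / β)]
  have h3 : -(u * d) ≤ β * u ^ 2 / 2 + d ^ 2 / β / 2 := by
    have : d ^ 2 / β = β * (d / β) ^ 2 := by field_simp
    have h' : u * d = β * (u * (d / β)) := by field_simp
    rw [this, h']
    nlinarith [sq_nonneg (u + d / β)]
  linarith

section Regret

variable {X A : Type*} [Countable X] [Countable A] [MeasurableSpace X] [DiscreteMeasurableSpace X]
  [MeasurableSpace A] [DiscreteMeasurableSpace A] {ρ : PMF X} {πref : Policy X A}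

lemma tripleLaw_map (ρ : PMF X) (πref : Policy X A) :
    (tripleLaw ρ πref).map (fun t => (t.1, t.2.2)) = joint ρ πref := by
  simp only [tripleLaw, joint, PMF.map_bind, PMF.map_comp]
  simp [Function.comp_def]

lemma integral_tripleLaw_marginal (f : X × A → ℝ) :
    ∫ t, f (t.1, t.2.2) ∂(tripleLaw ρ πref).toMeasure = ∫ p, f p ∂(joint ρ πref).toMeasure := by
  rw [← tripleLaw_map, integral_pmf_map]

lemma integrable_tripleLaw_marginal {f : X × A → ℝ} (hf : Integrable f (joint ρ πref).toMeasure) :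
    Integrable (fun t : X × A × A => f (t.1, t.2.2)) (tripleLaw ρ πref).toMeasure := by
  rwa [← tripleLaw_map, integrable_pmf_map_iff] at hf

/-- Given (x, a⁰), both ratios at a¹ have mean one. Any function of (x, a⁰) can thus be used as a
baseline in the regret. -/
lemma integral_tripleLaw_ratio_sub_mul_eq_zero (href : ∀ x a, πref x a ≠ 0) (π π' : Policy X A)
    (g : X → A → ℝ)
    (hint : Integrable (fun t : X × A × A =>
      (ratio πref π' t.1 t.2.2 - ratio πref π t.1 t.2.2) * g t.1 t.2.1)
      (tripleLaw ρ πref).toMeasure) :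
    ∫ t, (ratio πref π' t.1 t.2.2 - ratio πref π t.1 t.2.2) * g t.1 t.2.1
      ∂(tripleLaw ρ πref).toMeasure = 0 := by
  have hlaw : tripleLaw ρ πref = (ρ.bind fun x => (πref x).map fun a0 => (x, a0)).bind
      fun p => (πref p.1).map fun a1 => (p.1, p.2, a1) := by
    simp only [tripleLaw, PMF.bind_bind, PMF.bind_map]
    rfl
  rw [hlaw] at hint ⊢
  rw [integral_pmf_bind _ _ hint]
  refine integral_eq_zero_of_ae (Filter.Eventually.of_forall fun p => ?_)
  dsimp only
  rw [integral_pmf_map]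
  dsimp only
  rw [integral_mul_const, integral_sub (integrable_ratio_fiber href _ _)
    (integrable_ratio_fiber href _ _), integral_ratio_fiber href, integral_ratio_fiber href]
  simp

/-- The regret of a policy is controlled by the squared error of its implicit reward
differences. -/
lemma subGap_le (hρ : ∀ x, ρ x ≠ 0) (href : ∀ x a, πref x a ≠ 0) {β V R : ℝ} (hβ : 0 < β)
    {r : X → A → ℝ} (hr : ∀ x a, |r x a| ≤ R) {Pi : Finset (Policy X A)}
    (hB : BoundedImplicitReward πref β V Pi) {π πstar : Policy X A} (hπ : π ∈ Pi) {C : ℝ≥0}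
    (hC : concentrability ρ πref πstar = C) :
    subGap ρ r π πstar ≤ 5 / 2 * β * C + (∫ t, ((r t.1 t.2.2 - r t.1 t.2.1) -
      (implicitReward πref β π t.1 t.2.2 - implicitReward πref β π t.1 t.2.1)) ^ 2
        ∂(tripleLaw ρ πref).toMeasure) / β := by
  set ν := (tripleLaw ρ πref).toMeasure with hν
  set h := implicitReward πref β π
  have hhb : ∀ x a, |h x a| ≤ β + V := abs_implicitReward_le href hβ hB hπ
  have hu := integrable_tripleLaw_marginal (integrable_ratio hρ href π)
  have hv := integrable_tripleLaw_marginal (integrable_ratio hρ href πstar)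
  have hv2 := integrable_tripleLaw_marginal (integrable_ratio_sq hρ href hC)
  rw [← hν] at hu hv hv2
  dsimp only at hu hv hv2
  have hbdd : ∀ {f : X × A × A → ℝ} (M : ℝ), (∀ t, |f t| ≤ M) → Integrable (fun t =>
      (ratio πref πstar t.1 t.2.2 - ratio πref π t.1 t.2.2) * f t) ν := fun M hM =>
    (hv.sub hu).mul_bdd (Measurable.of_discrete).aestronglyMeasurable
      (Filter.Eventually.of_forall hM)
  have hi1 := hbdd R fun t : X × A × A => hr t.1 t.2.2
  have hi2 : Integrable (fun t : X × A × A =>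
      (ratio πref πstar t.1 t.2.2 - ratio πref π t.1 t.2.2) * (r t.1 t.2.1 - h t.1 t.2.1)) ν :=
    hbdd (R + (β + V)) fun t => (abs_sub _ _).trans (add_le_add (hr _ _) (hhb _ _))
  -- The baseline r − h at a⁰ turns the reward at a¹ into the difference error plus h at a¹.
  have hgap : subGap ρ r π πstar = ∫ t, (ratio πref πstar t.1 t.2.2 - ratio πref π t.1 t.2.2) *
      ((r t.1 t.2.2 - r t.1 t.2.1 - (h t.1 t.2.2 - h t.1 t.2.1)) + h t.1 t.2.2) ∂ν := by
    have hrv : ∀ π' : Policy X A, Integrable (fun p : X × A => ratio πref π' p.1 p.2 * r p.1 p.2)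
        (joint ρ πref).toMeasure := fun π' =>
      (integrable_ratio hρ href π').mul_bdd (Measurable.of_discrete).aestronglyMeasurable
        (Filter.Eventually.of_forall fun p => hr p.1 p.2)
    have h1 : subGap ρ r π πstar = ∫ t : X × A × A,
        (ratio πref πstar t.1 t.2.2 - ratio πref π t.1 t.2.2) * r t.1 t.2.2 ∂ν := by
      rw [subGap, value, value, integral_joint_eq hρ href πstar, integral_joint_eq hρ href π,
        ← integral_sub (hrv _) (hrv _), ← integral_tripleLaw_marginal]
      refine integral_congr_ae (Filter.Eventually.of_forall fun t => ?_)
      dsimp only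
      ring
    have h2 := integral_tripleLaw_ratio_sub_mul_eq_zero href π πstar
      (fun x a => r x a - h x a) hi2
    rw [h1, ← sub_zero (∫ t : X × A × A, _ ∂ν), ← h2, ← integral_sub hi1 hi2]
    refine integral_congr_ae (Filter.Eventually.of_forall fun t => ?_)
    dsimp only
    ring
  have hd : ∀ t : X × A × A, |r t.1 t.2.2 - r t.1 t.2.1 - (h t.1 t.2.2 - h t.1 t.2.1)| ≤
      2 * R + V := fun t => by
    have h1 := abs_le.1 (hr t.1 t.2.2)
    have h2 := abs_le.1 (hr t.1 t.2.1)
    have h3 := abs_le.1 ((hB π hπ t.1).2 t.2.2 t.2.1)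
    rw [abs_le]
    constructor <;> linarith
  have hd2 : Integrable (fun t : X × A × A =>
      (r t.1 t.2.2 - r t.1 t.2.1 - (h t.1 t.2.2 - h t.1 t.2.1)) ^ 2) ν :=
    integrable_of_abs_le ((2 * R + V) ^ 2) fun t => by
      rw [abs_pow]
      exact pow_le_pow_left₀ (abs_nonneg _) (hd t) 2
  have hl := hbdd (2 * R + V + (β + V)) fun t : X × A × A =>
    (abs_add_le _ _).trans (add_le_add (hd t) (hhb t.1 t.2.2))
  have hA := (hv2.const_mul (5 / 2 * β)).add (hd2.div_const β)
  have hu1 : Integrable (fun t : X × A × A => 1 - ratio πref π t.1 t.2.2) ν :=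
    (integrable_const 1).sub hu
  have hE : Integrable (fun t : X × A × A =>
      β * (1 - ratio πref π t.1 t.2.2 - ratio πref πstar t.1 t.2.2)) ν :=
    (hu1.sub hv).const_mul β
  rw [hgap]
  refine (integral_mono hl (hA.add hE) fun t => sub_mul_add_le hβ
    (ratio_pos_of_bounded href hB hπ _ _) (ratio_nonneg _ _ _ _)).trans ?_
  have e1 := integral_tripleLaw_marginal (ρ := ρ) (πref := πref)
    fun p : X × A => ratio πref π p.1 p.2
  have e2 := integral_tripleLaw_marginal (ρ := ρ) (πref := πref)
    fun p : X × A => ratio πref πstar p.1 p.2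
  have e3 := integral_tripleLaw_marginal (ρ := ρ) (πref := πref)
    fun p : X × A => ratio πref πstar p.1 p.2 ^ 2
  rw [integral_ratio hρ href] at e1 e2
  rw [integral_ratio_sq hρ href hC] at e3
  rw [← hν] at e1 e2 e3
  dsimp only at e1 e2 e3
  -- The remainder β(1 − u − v) integrates to −β and is dropped.
  rw [integral_add' hA hE, integral_add' (hv2.const_mul (5 / 2 * β)) (hd2.div_const β),
    integral_const_mul, integral_const_mul, integral_div, integral_sub hu1 hv, integral_sub (integrable_const 1) hu, e1, e2, e3]
  simp
  linarith

end Regret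

/-! ### Assembling the bound -/

section Main

variable {X A : Type*}

/-- The prediction of the label made by a policy. -/
noncomputable def prediction (πref : Policy X A) (R β : ℝ) (π : Policy X A) (t : X × A × A) : ℝ :=
  2 * Real.sigmoid (clip (2 * R)
    (β * (phi (ratio πref π t.1 t.2.2) - phi (ratio πref π t.1 t.2.1)))) - 1

lemma squareLoss_eq {n : ℕ} (πref : Policy X A) (R ε β : ℝ) (D : Fin n → Sample X A)
    (π : Policy X A) : squareLoss πref R ε β D π =
      ∑ i, (prediction πref R β π (D i).triple - cEps ε * signLabel (D i).2.2.2) ^ 2 := rfl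

variable [Countable X] [Countable A] [MeasurableSpace X] [DiscreteMeasurableSpace X]
  [MeasurableSpace A] [DiscreteMeasurableSpace A] {ρ : PMF X} {πref : Policy X A}

lemma abs_sub_le_of_mem {r : X → A → ℝ} {R : ℝ} (hr : ∀ x a, 0 ≤ r x a ∧ r x a ≤ R) (x : X)
    (a b : A) : |r x a - r x b| ≤ R := by
  rw [abs_le]
  constructor <;> linarith [(hr x a).1, (hr x a).2, (hr x b).1, (hr x b).2]

/-- Reward differences are at most R in absolute value, so clipping at 2R leaves the regularized
maximizer's implicit differences untouched. -/
lemma exists_prediction_eq_cleanMean (hρ : ∀ x, ρ x ≠ 0) (href : ∀ x a, πref x a ≠ 0)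
    {β V R : ℝ} (hβ : 0 < β) (hR : 0 < R) {r : X → A → ℝ} (hr : ∀ x a, 0 ≤ r x a ∧ r x a ≤ R)
    {Pi : Finset (Policy X A)} (hreal : Realizable ρ πref r β Pi)
    (hB : BoundedImplicitReward πref β V Pi) :
    ∃ π ∈ Pi, ∀ t, prediction πref R β π t = cleanMean r t := by
  obtain ⟨π, hπ, hmax⟩ := hreal
  refine ⟨π, hπ, fun t => ?_⟩
  have h := implicitReward_sub_eq hρ href hβ (fun x => (hB π hπ x).1)
    (ratio_le_of_bounded href hβ hB hπ) (R := R)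
    (fun x a => by rw [abs_of_nonneg (hr x a).1]; exact (hr x a).2) hmax t.1 t.2.2 t.2.1
  have h2 : |r t.1 t.2.2 - r t.1 t.2.1| ≤ 2 * R := (abs_sub_le_of_mem hr _ _ _).trans (by linarith)
  rw [prediction, mul_sub]
  change 2 * Real.sigmoid (clip (2 * R) (implicitReward πref β π t.1 t.2.2 -
    implicitReward πref β π t.1 t.2.1)) - 1 = _
  rw [h, clip_of_abs_le h2, cleanMean]

lemma integral_sq_implicitReward_sub_le {β V R : ℝ} (hR : 0 < R) (hRV : R ≤ V)
    {r : X → A → ℝ} (hr : ∀ x a, 0 ≤ r x a ∧ r x a ≤ R) {Pi : Finset (Policy X A)}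
    (hB : BoundedImplicitReward πref β V Pi) {π : Policy X A} (hπ : π ∈ Pi) :
    ∫ t, ((r t.1 t.2.2 - r t.1 t.2.1) -
      (implicitReward πref β π t.1 t.2.2 - implicitReward πref β π t.1 t.2.1)) ^ 2
        ∂(tripleLaw ρ πref).toMeasure ≤
      (4 * (Real.exp (2 * R) * (V / R))) ^ 2 *
        meanSqError ρ πref r (prediction πref R β π) := by
  rw [meanSqError, ← integral_const_mul]
  refine integral_mono_of_nonneg (Filter.Eventually.of_forall fun _ => sq_nonneg _)
    (Integrable.const_mul (integrable_of_abs_le 4 fun t => ?_) _)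
    (Filter.Eventually.of_forall fun t => ?_)
  · have h1 : |prediction πref R β π t| ≤ 1 := abs_two_mul_sigmoid_sub_one_le _
    have h2 : |cleanMean r t| ≤ 1 := abs_two_mul_sigmoid_sub_one_le _
    rw [abs_of_nonneg (sq_nonneg _), ← sq_abs]
    have := (abs_sub (prediction πref R β π t) (cleanMean r t)).trans (add_le_add h1 h2)
    nlinarith [abs_nonneg (prediction πref R β π t - cleanMean r t)]
  · have := sq_sub_le_sq_sigmoid_clip_sub hR hRV (abs_sub_le_of_mem hr t.1 t.2.2 t.2.1)
      ((hB π hπ t.1).2 t.2.2 t.2.1)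
    simpa only [prediction, mul_sub, cleanMean, implicitReward] using this

lemma sqrt_error_le {b c L : ℝ} (hb : 0 ≤ b) (hc : 0 ≤ c) (hL : 0 ≤ L) :
    Real.sqrt (16 * b + 64 * c ^ 2 * L) ≤ 8 * (c * Real.sqrt L + Real.sqrt b) := by
  have h1 := Real.sqrt_nonneg b
  have h2 := Real.sqrt_nonneg L
  refine Real.sqrt_le_iff.2 ⟨by positivity, ?_⟩
  have h3 : 0 ≤ c * Real.sqrt L * Real.sqrt b := by positivity
  have e1 := Real.sq_sqrt hb
  have e2 := Real.sq_sqrt hL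
  calc 16 * b + 64 * c ^ 2 * L = 16 * Real.sqrt b ^ 2 + 64 * c ^ 2 * Real.sqrt L ^ 2 := by
        rw [e1, e2]
    _ ≤ _ := by nlinarith

end Main

end SquareChiPO

theorem theorem1 :
    ∃ K : ℝ, 0 < K ∧
    ∀ (s : Setting) (n N : ℕ) (ε α ζ Rmax Vmax : ℝ) (C : ℝ≥0),
      0 < n → 0 < ε → 0 ≤ α → α ≤ 1 / 2 → 0 < ζ → ζ < 1 → 0 < Rmax → Rmax ≤ Vmax →
      ∃ β : ℝ, 0 < β ∧
      ∀ (X : Type u) (A : Type v) [Countable X] [Countable A]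
        [MeasurableSpace X] [DiscreteMeasurableSpace X]
        [MeasurableSpace A] [DiscreteMeasurableSpace A]
        (ρ : PMF X) (πref : Policy X A) (r : X → A → ℝ) (πstar : Policy X A)
        (Pi : Finset (Policy X A)) (B : Fin n → X → A → A → PMF Bool),
        (∀ x, ρ x ≠ 0) → (∀ x a, πref x a ≠ 0) →
        (∀ x a, 0 ≤ r x a ∧ r x a ≤ Rmax) →
        concentrability ρ πref πstar = C →
        Pi.card = N →
        Realizable ρ πref r β Pi →
        BoundedImplicitReward πref β Vmax Pi →
        ENNReal.ofReal (1 - ζ) ≤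
          datasetLaw s n ρ πref r ε α B
            {D | ∀ πhat : Policy X A, IsOutput πref Rmax ε β Pi D πhat →
              subGap ρ r πhat πstar ≤
                K * (kappa Rmax Vmax C *
                  (cEps ε * Real.sqrt (Real.log (N / ζ) / n) + corruptionTerm s ε α))} := by
  -- 112 = (5/2 + 1) · 4 · 8: balancing in β, the factor 4 in `err`, and `sqrt_error_le`.
  refine ⟨112, by norm_num, ?_⟩
  intro s n N ε α ζ R V C hn hε h0 h1 hζ hζ1 hR hRV
  have hV : 0 < V := hR.trans_le hRV
  set thr := 16 * corruptionLevel s ε α + 64 * cEps ε ^ 2 * (Real.log (N / ζ) / n) with hthr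
  set err := 4 * (Real.exp (2 * R) * (V / R)) * Real.sqrt thr with herr
  -- β is fixed before the spaces and the class are given, so degenerate values such as C = 0 or N =
  -- 0 must be covered. No instance realizes them (C ≥ 1 and N ≥ 1), so any positive β will do.
  by_cases hpos : ¬ 0 < err / Real.sqrt C
  · refine ⟨1, one_pos, ?_⟩
    intro X A _ _ _ _ _ _ ρ πref r πstar Pi B hρ href hr hC hN hreal hB
    have hC1 := one_le_concentrability hρ href hC
    obtain ⟨π, hπ, -⟩ := hreal
    have hN0 : (1 : ℝ) ≤ N := by
      rw [← hN]
      exact_mod_cast Finset.card_pos.2 ⟨π, hπ⟩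
    refine absurd ?_ hpos
    have hlog : 0 < Real.log (N / ζ) := Real.log_pos (by rw [lt_div_iff₀ hζ]; linarith)
    have hc := cEps_one_le hε
    have hb := corruptionLevel_nonneg s hε h0
    have hn' : (0 : ℝ) < n := by exact_mod_cast hn
    have : 0 < thr := by positivity
    positivity
  rw [not_not] at hpos
  set β := err / Real.sqrt C with hβdef
  refine ⟨β, hpos, ?_⟩
  intro X A _ _ _ _ _ _ ρ πref r πstar Pi B hρ href hr hC hN hreal hB
  have hC1 := one_le_concentrability hρ href hC
  obtain ⟨π0, hπ0, hπ0eq⟩ := exists_prediction_eq_cleanMean hρ href hpos hR hr hreal hB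
  have hconc := le_datasetLaw_meanSqError_le (ρ := ρ) (πref := πref) s hn hε h0 (by linarith) hζ r
    B Pi (F := prediction πref R β) fun _ _ => abs_two_mul_sigmoid_sub_one_le _
  rw [hN] at hconc
  refine hconc.trans (measure_mono fun D hD πhat hout => ?_)
  have hmse : meanSqError ρ πref r (prediction πref R β πhat) ≤ thr := by
    refine hD πhat hout.1 ?_
    -- As `π0` predicts the clean mean, beating it in loss means nonpositive total excess loss.
    have h := hout.2 π0 hπ0
    rw [squareLoss_eq, squareLoss_eq] at h
    simp_rw [hπ0eq] at h
    simp only [excessLoss, Finset.sum_sub_distrib]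
    linarith
  have hthr0 : 0 ≤ thr := (integral_nonneg fun _ => sq_nonneg _).trans hmse
  have hsq : Real.sqrt C * Real.sqrt C = C := Real.mul_self_sqrt (by positivity)
  have hsC : 0 < Real.sqrt C := Real.sqrt_pos.2 (by linarith)
  have herr0 : 0 < err := by
    have := mul_pos hpos hsC
    rwa [hβdef, div_mul_cancel₀ _ hsC.ne'] at this
  have herr2 : err ^ 2 = (4 * (Real.exp (2 * R) * (V / R))) ^ 2 * thr := by
    rw [herr, mul_pow, Real.sq_sqrt hthr0]
  have hN0 : (1 : ℝ) ≤ N := by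
    rw [← hN]
    exact_mod_cast Finset.card_pos.2 ⟨π0, hπ0⟩
  have hlog : 0 ≤ Real.log (N / ζ) / n :=
    div_nonneg (Real.log_nonneg (by rw [le_div_iff₀ hζ]; linarith)) (Nat.cast_nonneg n)
  have hc := cEps_one_le hε
  calc subGap ρ r πhat πstar ≤ _ := subGap_le hρ href hpos (R := R)
        (fun x a => by rw [abs_of_nonneg (hr x a).1]; exact (hr x a).2) hB hout.1 hC
    _ ≤ 5 / 2 * β * C + err ^ 2 / β := by
        gcongr
        refine (integral_sq_implicitReward_sub_le hR hRV hr hB hout.1).trans ?_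
        rw [herr2]
        gcongr
    -- With β = err/√C, both βC and err²/β equal √C · err.
    _ = 7 / 2 * (Real.sqrt C * err) := by
        rw [hβdef]
        nth_rewrite 2 [← hsq]
        field_simp
        ring
    _ = 14 * (kappa R V C * Real.sqrt thr) := by
        rw [herr, kappa]
        ring
    _ ≤ 14 * (kappa R V C * (8 * (cEps ε * Real.sqrt (Real.log (N / ζ) / n) +
          Real.sqrt (corruptionLevel s ε α)))) := by
        have hk : 0 ≤ kappa R V C := by
          unfold kappa
          positivity
        gcongr
        exact sqrt_error_le (corruptionLevel_nonneg s hε h0) (by linarith) hlog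
    _ = _ := by
        rw [corruptionTerm_eq]
        ring
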